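/- **Setting.** Let $\mathcal A$ be a complex unital associative algebra and let $A_{ij}=A_{ji}\in\mathcal A$ ($1\le i\ne j\le 4$) satisfy the infinitesimal braid relations $[A_{ij}+A_{ik},A_{jk}]=0$ for pairwise distinct $i,j,k$ and $[A_{ij},A_{kl}]=0$ for pairwise distinct $i,j,k,l$. On the open triangle $U'=\{(x_2,x_3)\in\mathbb R^2: 0<x_2<x_3<1\}$ let $$\Gamma=\Big(\frac{A_{12}}{x_2}+\frac{A_{23}}{x_2-x_3}+\frac{A_{24}}{x_2-1}\Big)\mathsf dx_2+\Big(\frac{A_{13}}{x_3}-\frac{A_{23}}{x_2-x_3}+\frac{A_{34}}{x_3-1}\Big)\mathsf dx_3 ,$$ the pull-back of the Knizhnik–Zamolodchikov connection $\sum_{1\le i<j\le 4}\frac{A_{ij}}{z_i-z_j}(\mathsf dz_i-\mathsf dz_j)$ by $(x_2,x_3)\mapsto(0,x_2,x_3,1)$. *Parallel transport.* For a formal connection $\Gamma=\sum_i\Gamma_i\,\mathsf dx_i$ on a set $U\subset\mathbb R^N$, with $\Gamma_i\in (C^\infty(U,\mathbb C)\otimes\mathcal A)[[\lambda]]$, and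 a smooth path $c:[0,1]\to U$, put $\Gamma^{(c)}=\sum_i(\Gamma_i\circ c)\frac{\mathsf dc_i}{\mathsf ds}$. The parallel transport ${}^{\Gamma}W^{(c)}_{10}\in\mathcal A[[\lambda]]$ is the value at $s=1$ of the unique $W\in(C^\infty([0,1],\mathbb C)\otimes\mathcal A)[[\lambda]]$ with $\frac{\mathsf dW}{\mathsf ds}=\lambda\,\Gamma^{(c)}W$, $W(0)=1$. When $\Gamma$ is clear, write $W^{(c)}_{10}$. *The terms $\psi_\epsilon$.* For $A,B\in\mathcal A$ and $0<\epsilon\le\frac14$, the invertible series $\psi_\epsilon(B,A)\in\mathcal A[[\lambda]]$ is defined by ${}^{\Gamma(B,A)}W^{(\tilde c_\epsilon)}_{10}=e^{\lambda\ln(\epsilon)B}\,\psi_\epsilon(B,A)$, where $\Gamma(B,A)=\big(\frac1xA+\frac1{x-1}B\big)\mathsf dx$ on $]0,1[$ and $\tilde c_\epsilon(s)=1-\frac12e^{\ln(2\epsilon)s}$, a path from $\frac12$ to $1-\epsilon$. *Harmless terms.* Let $J=\,]0,\frac14]$. An element $F=\sum_rF_r\lambda^r$ of $(\mathrm{Fun}(J,\mathbb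 C)\otimes\mathcal A)[[\lambda]]$ is harmless if, for any norm $\|\cdot\|$ on the complex vector space $\mathcal A$ and every $r$, there are $C_r\ge0$ and $\beta_r>0$ with $\|F_r(\delta)\|\le C_r\delta^{\beta_r}$ for all $\delta\in J$ (the choice of the norm does not matter). A harmless group term is an element of the form $1+\lambda F$ with $F$ harmless. *The pentagon.* For $\delta\in J$ let $p_1=(\delta^2,\delta)$, $p_2=(\delta-\delta^2,\delta)$, $p_3=(1-\delta,1-\delta+\delta^2)$, $p_4=(1-\delta,1-\delta^2)$, $p_5=(\delta^2,1-\delta^2)$, and let $c_{q\leftarrow p}(s)=(1-s)p+sq$. Put $c_{\mathrm I}=c_{p_2\leftarrow p_1}$, $c_{\mathrm{II}}=c_{p_3\leftarrow p_2}$, $c_{\mathrm{III}}=c_{p_4\leftarrow p_3}$, $c_{\mathrm{IV}}=c_{p_5\leftarrow p_1}$, $c_{\mathrm V}=c_{p_4\leftarrow p_5}$; these are paths in $U'$ depending on $\delta$. **Lemma.** There are harmless group terms $\delta\mapsto H^{(\mathrm I,\delta)},\dots,H^{(\mathrm V,\delta)}$ such that for all $\delta\in J$, with respect to $\Gamma$,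 $$\begin{aligned} W_{10}^{(c_{\mathrm I})}&=e^{\lambda\ln(\delta)A_{23}}\,\psi_\delta(A_{23},A_{12})\,H^{(\mathrm I,\delta)}\,\psi_\delta(A_{12},A_{23})^{-1}\,e^{-\lambda\ln(\delta)A_{12}},\\ W_{10}^{(c_{\mathrm{II}})}&=e^{\lambda\ln(\delta)(A_{24}+A_{34})}\,\psi_\delta(A_{24}+A_{34},A_{12}+A_{13})\,H^{(\mathrm{II},\delta)}\,\psi_\delta(A_{12}+A_{13},A_{24}+A_{34})^{-1}\,e^{-\lambda\ln(\delta)(A_{12}+A_{13})},\\ W_{10}^{(c_{\mathrm{III}})}&=e^{\lambda\ln(\delta)A_{34}}\,\psi_\delta(A_{34},A_{23})\,H^{(\mathrm{III},\delta)}\,\psi_\delta(A_{23},A_{34})^{-1}\,e^{-\lambda\ln(\delta)A_{23}},\\ W_{10}^{(c_{\mathrm{IV}})}&=e^{\lambda\ln(\delta^2)A_{34}}\,\psi_{\delta^2}(A_{34},A_{13}+A_{23})\,H^{(\mathrm{IV},\delta)}\,\psi_\delta(A_{13}+A_{23},A_{34})^{-1}\,e^{-\lambda\ln(\delta)(A_{13}+A_{23})},\\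 W_{10}^{(c_{\mathrm V})}&=e^{\lambda\ln(\delta)(A_{23}+A_{24})}\,\psi_\delta(A_{23}+A_{24},A_{12})\,H^{(\mathrm V,\delta)}\,\psi_{\delta^2}(A_{12},A_{23}+A_{24})^{-1}\,e^{-\lambda\ln(\delta^2)A_{12}}. \end{aligned}$$ -/

import Mathlib

open scoped TensorProduct PowerSeries ContDiff

namespace KZPentagon

noncomputable section

/-! ## Smooth functions -/

/-- The complex algebra of smooth complex-valued functions on a subset `S` of a real normed space.
It is used for open sets `S = U ⊆ ℝ^N`, giving `C^∞(U, ℂ)`, and for `S = [0,1]`, giving the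
functions that are smooth on `]0,1[` and all of whose derivatives have limits at `0` and `1`
(with the values at `0` and `1` given by continuity). -/
def smoothFun {E : Type*} [NormedAddCommGroup E] [NormedSpace ℝ E] (S : Set E) :
    Subalgebra ℂ (S → ℂ) where
  carrier := {f | ∃ g : E → ℂ, ContDiffOn ℝ ∞ g S ∧ ∀ x : S, f x = g x}
  mul_mem' := by
    rintro f₁ f₂ ⟨g₁, h₁, e₁⟩ ⟨g₂, h₂, e₂⟩
    exact ⟨g₁ * g₂, h₁.mul h₂, fun x => by simp [e₁, e₂]⟩
  add_mem' := by
    rintro f₁ f₂ ⟨g₁, h₁, e₁⟩ ⟨g₂, h₂, e₂⟩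
    exact ⟨g₁ + g₂, h₁.add h₂, fun x => by simp [e₁, e₂]⟩
  algebraMap_mem' := fun c => ⟨fun _ => c, contDiffOn_const, fun _ => rfl⟩

/-- The smooth function on `S` given by the restriction of `g`. -/
def smoothRestrict {E : Type*} [NormedAddCommGroup E] [NormedSpace ℝ E] {S : Set E}
    (g : E → ℂ) (hg : ContDiffOn ℝ ∞ g S) : smoothFun S :=
  ⟨fun x => g x, g, hg, fun _ => rfl⟩

/-- Evaluation of a smooth function at a point of `S`. -/
def evalSmooth {E : Type*} [NormedAddCommGroup E] [NormedSpace ℝ E] {S : Set E} (x : S) :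
    smoothFun S →ₐ[ℂ] ℂ :=
  (Pi.evalAlgHom ℂ (fun _ : S => ℂ) x).comp (smoothFun S).val

/-- Composition `f ↦ f ∘ c` with a smooth map `c` from `S` to `T`. -/
def compSmooth {E F : Type*} [NormedAddCommGroup E] [NormedSpace ℝ E]
    [NormedAddCommGroup F] [NormedSpace ℝ F] {S : Set E} {T : Set F}
    (c : E → F) (hc : ContDiffOn ℝ ∞ c S) (hST : Set.MapsTo c S T) :
    smoothFun T →ₐ[ℂ] smoothFun S where
  toFun f := ⟨fun x => f.1 ⟨c x, hST x.2⟩, by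
    obtain ⟨g, hg, e⟩ := f.2
    exact ⟨g ∘ c, hg.comp hc hST, fun x => e _⟩⟩
  map_one' := rfl
  map_mul' _ _ := rfl
  map_zero' := rfl
  map_add' _ _ := rfl
  commutes' _ := rfl

/-- The closed unit interval as a subset of the real line. -/
abbrev I01 : Set ℝ := Set.Icc 0 1

/-- A smooth function on `[0,1]`, extended to the real line by constants. -/
def extendI01 (f : I01 → ℂ) : ℝ → ℂ := Set.IccExtend zero_le_one f

theorem extendI01_apply (f : I01 → ℂ) (x : I01) : extendI01 f x = f x :=
  Set.IccExtend_val _ _ _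

theorem contDiffOn_extendI01 (f : smoothFun I01) : ContDiffOn ℝ ∞ (extendI01 f.1) I01 := by
  obtain ⟨g, hg, e⟩ := f.2
  refine hg.congr fun x hx => ?_
  rw [← e ⟨x, hx⟩]
  exact extendI01_apply _ ⟨x, hx⟩

/-- The derivative `d/ds` on smooth functions on `[0,1]` (one-sided at the end points). -/
def derivSmooth : smoothFun I01 →ₗ[ℂ] smoothFun I01 where
  toFun f := smoothRestrict (derivWithin (extendI01 f.1) I01)
    (((contDiffOn_infty_iff_derivWithin (uniqueDiffOn_Icc zero_lt_one)).1
      (contDiffOn_extendI01 f)).2)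
  map_add' f g := by
    ext x
    have hf := (contDiffOn_extendI01 f).differentiableOn (by simp) x x.2
    have hg := (contDiffOn_extendI01 g).differentiableOn (by simp) x x.2
    exact derivWithin_add hf hg
  map_smul' c f := by
    ext x
    have hf := (contDiffOn_extendI01 f).differentiableOn (by simp) x x.2
    exact derivWithin_const_smul c hf

theorem hasDerivWithinAt_primitive (f : smoothFun I01) (x : ℝ) :
    HasDerivWithinAt (fun s => ∫ t in (0 : ℝ)..s, extendI01 f.1 t) (extendI01 f.1 x) I01 x := by
  have hc : Continuous (extendI01 f.1) := by
    have h := (contDiffOn_extendI01 f).continuousOn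
    have h2 : Continuous f.1 := by
      rw [continuousOn_iff_continuous_domRestrict] at h
      refine h.congr fun y => extendI01_apply _ y
    exact h2.Icc_extend'
  exact (intervalIntegral.integral_hasDerivAt_right (hc.intervalIntegrable _ _)
    hc.stronglyMeasurable.stronglyMeasurableAtFilter hc.continuousAt).hasDerivWithinAt

/-- The primitive `s ↦ ∫₀ˢ f(t) dt` on smooth functions on `[0,1]`. -/
def primitiveSmooth : smoothFun I01 →ₗ[ℂ] smoothFun I01 where
  toFun f := smoothRestrict (fun s => ∫ t in (0 : ℝ)..s, extendI01 f.1 t) (by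
    rw [contDiffOn_infty_iff_derivWithin (uniqueDiffOn_Icc zero_lt_one)]
    refine ⟨fun x _ => (hasDerivWithinAt_primitive f x).differentiableWithinAt, ?_⟩
    refine (contDiffOn_extendI01 f).congr fun x hx => ?_
    exact (hasDerivWithinAt_primitive f x).derivWithin (uniqueDiffOn_Icc zero_lt_one x hx))
  map_add' f g := by
    have hc : ∀ f : smoothFun I01, ∀ s ∈ I01,
        IntervalIntegrable (extendI01 f.1) MeasureTheory.volume 0 s := fun f s hs =>
      (((contDiffOn_extendI01 f).continuousOn).mono (by
        rw [Set.uIcc_of_le hs.1]; exact Set.Icc_subset_Icc_right hs.2)).intervalIntegrable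
    ext x
    exact intervalIntegral.integral_add (hc f x x.2) (hc g x x.2)
  map_smul' c f := by
    ext x
    exact intervalIntegral.integral_smul c (extendI01 f.1)

theorem deriv_primitiveSmooth (f : smoothFun I01) : derivSmooth (primitiveSmooth f) = f := by
  ext x
  have h := hasDerivWithinAt_primitive f x
  have h2 : HasDerivWithinAt (extendI01 (primitiveSmooth f).1) (extendI01 f.1 x) I01 x :=
    h.congr (fun y hy => extendI01_apply _ ⟨y, hy⟩) (extendI01_apply _ x)
  rw [extendI01_apply] at h2
  exact h2.derivWithin (uniqueDiffOn_Icc zero_lt_one x x.2)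

theorem primitive_derivSmooth (f : smoothFun I01) :
    primitiveSmooth (derivSmooth f) =
      f - algebraMap ℂ _ (evalSmooth (⟨0, by simp⟩ : I01) f) := by
  ext x
  have hsub : Set.uIcc (0 : ℝ) x ⊆ I01 := by
    rw [Set.uIcc_of_le x.2.1]; exact Set.Icc_subset_Icc_right x.2.2
  have hd := contDiffOn_extendI01 (derivSmooth f)
  have key : ∫ t in (0 : ℝ)..x, extendI01 (derivSmooth f).1 t =
      extendI01 f.1 x - extendI01 f.1 0 := by
    refine intervalIntegral.integral_eq_sub_of_hasDeriv_right_of_le x.2.1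
      ((contDiffOn_extendI01 f).continuousOn.mono (Set.Icc_subset_Icc_right x.2.2))
      (fun y hy => ?_) ((hd.continuousOn.mono hsub).intervalIntegrable)
    have hy1 : y ∈ I01 := ⟨hy.1.le, hy.2.le.trans x.2.2⟩
    have h3 := ((contDiffOn_extendI01 f).differentiableOn (by simp) y hy1).hasDerivWithinAt
    have h4 : extendI01 (derivSmooth f).1 y = derivWithin (extendI01 f.1) I01 y :=
      extendI01_apply _ ⟨y, hy1⟩
    rw [h4]
    exact (h3.hasDerivAt (Icc_mem_nhds hy.1 (hy.2.trans_le x.2.2))).hasDerivWithinAt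
  have h0 : extendI01 f.1 0 = f.1 ⟨0, by simp⟩ := extendI01_apply f.1 ⟨0, by simp⟩
  rw [extendI01_apply, h0] at key
  exact key

/-! ## Formal linear ordinary differential equations

`𝒜` is a complex unital associative algebra, and `𝒜⟦X⟧` is `𝒜[[λ]]`, with `X` in the role of `λ`. -/

variable {𝒜 : Type*} [Ring 𝒜] [Algebra ℂ 𝒜]

/-- The map `R ⊗ 𝒜 → 𝒜` induced by a character `φ` of the complex algebra `R`. For an evaluation
`φ` it is the evaluation of an element of `R ⊗ 𝒜`, seen as an `𝒜`-valued function. -/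
def evalTensor {R : Type*} [Ring R] [Algebra ℂ R] (φ : R →ₐ[ℂ] ℂ) : R ⊗[ℂ] 𝒜 →ₐ[ℂ] 𝒜 :=
  (Algebra.TensorProduct.lid ℂ 𝒜).toAlgHom.comp
    (Algebra.TensorProduct.map φ (AlgHom.id ℂ 𝒜))

/-- The derivative on `(C^∞([0,1]) ⊗ 𝒜)[[λ]]`, coefficientwise. -/
def derivSeries (F : (smoothFun I01 ⊗[ℂ] 𝒜)⟦X⟧) : (smoothFun I01 ⊗[ℂ] 𝒜)⟦X⟧ :=
  PowerSeries.mk fun r => derivSmooth.rTensor 𝒜 (PowerSeries.coeff r F)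

/-- The value at `s ∈ [0,1]` of an element of `(C^∞([0,1]) ⊗ 𝒜)[[λ]]`. -/
def evalSeries (s : I01) (F : (smoothFun I01 ⊗[ℂ] 𝒜)⟦X⟧) : 𝒜⟦X⟧ :=
  PowerSeries.map (evalTensor (𝒜 := 𝒜) (evalSmooth s)).toRingHom F

/-- The coefficients of the fundamental solution: `W₀ = 1` and
`W_{r+1}(s) = ∫₀ˢ ∑_{i+j=r} Y_i(t) W_j(t) dt`. -/
def fundamentalCoeff (Y : (smoothFun I01 ⊗[ℂ] 𝒜)⟦X⟧) : ℕ → smoothFun I01 ⊗[ℂ] 𝒜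
  | 0 => 1
  | r + 1 => primitiveSmooth.rTensor 𝒜
      (∑ j : Fin (r + 1), PowerSeries.coeff (r - j) Y * fundamentalCoeff Y j)

/-- The fundamental solution `W_{·0}` of `dW/ds = λ Y W`, normalized by `W(0) = 1`. -/
def fundamentalSolution (Y : (smoothFun I01 ⊗[ℂ] 𝒜)⟦X⟧) : (smoothFun I01 ⊗[ℂ] 𝒜)⟦X⟧ :=
  PowerSeries.mk (fundamentalCoeff Y)

theorem fundamentalSolution_deriv (Y : (smoothFun I01 ⊗[ℂ] 𝒜)⟦X⟧) :
    derivSeries (fundamentalSolution Y) = PowerSeries.X * (Y * fundamentalSolution Y) := by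
  have hdp : (derivSmooth.rTensor 𝒜).comp (primitiveSmooth.rTensor 𝒜) = LinearMap.id := by
    rw [← LinearMap.rTensor_comp, show derivSmooth.comp primitiveSmooth = LinearMap.id from
      LinearMap.ext deriv_primitiveSmooth, LinearMap.rTensor_id]
  ext r
  rw [derivSeries, fundamentalSolution, PowerSeries.coeff_mk, PowerSeries.coeff_mk]
  cases r with
  | zero =>
    have h : derivSmooth (1 : smoothFun I01) = 0 := by
      ext x
      have : derivWithin (extendI01 (1 : smoothFun I01).1) I01 x = 0 := by
        have : extendI01 (1 : smoothFun I01).1 = fun _ => (1 : ℂ) := rfl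
        rw [this]; simp
      exact this
    rw [PowerSeries.coeff_zero_X_mul, fundamentalCoeff, Algebra.TensorProduct.one_def,
      LinearMap.rTensor_tmul, h, TensorProduct.zero_tmul]
  | succ r =>
    rw [PowerSeries.coeff_succ_X_mul, fundamentalCoeff, ← LinearMap.comp_apply, hdp,
      LinearMap.id_apply, PowerSeries.coeff_mul,
      ← Finset.Nat.sum_antidiagonal_swap, Finset.Nat.sum_antidiagonal_eq_sum_range_succ_mk,
      Finset.sum_range]
    simp [PowerSeries.coeff_mk]

theorem evalSeries_fundamentalSolution_zero (Y : (smoothFun I01 ⊗[ℂ] 𝒜)⟦X⟧) :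
    evalSeries ⟨0, by simp⟩ (fundamentalSolution Y) = 1 := by
  have hp : (evalTensor (𝒜 := 𝒜) (evalSmooth (⟨0, by simp⟩ : I01))).toLinearMap.comp
      (primitiveSmooth.rTensor 𝒜) = 0 := by
    refine TensorProduct.ext' fun f a => ?_
    have : evalSmooth (⟨0, by simp⟩ : I01) (primitiveSmooth f) = 0 := by
      change ∫ t in (0 : ℝ)..0, extendI01 f.1 t = 0
      simp
    rw [LinearMap.comp_apply, LinearMap.rTensor_tmul]
    simp only [evalTensor, AlgHom.toLinearMap_apply, AlgHom.comp_apply,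
      Algebra.TensorProduct.map_tmul, this]
    simp
  ext r
  rw [evalSeries, PowerSeries.coeff_map, fundamentalSolution, PowerSeries.coeff_mk,
    PowerSeries.coeff_one]
  cases r with
  | zero => simp [fundamentalCoeff]
  | succ r =>
    rw [fundamentalCoeff]
    exact (LinearMap.congr_fun hp _).trans (by simp)

/-- The fundamental solution is the only solution of `dw/ds = λ Y w`, `w(0) = 1`. -/
theorem eq_fundamentalSolution (Y w : (smoothFun I01 ⊗[ℂ] 𝒜)⟦X⟧)
    (h : derivSeries w = PowerSeries.X * (Y * w)) (h0 : evalSeries ⟨0, by simp⟩ w = 1) :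
    w = fundamentalSolution Y := by
  have hpd : ∀ z : smoothFun I01 ⊗[ℂ] 𝒜, primitiveSmooth.rTensor 𝒜 (derivSmooth.rTensor 𝒜 z) +
      1 ⊗ₜ (evalTensor (𝒜 := 𝒜) (evalSmooth (⟨0, by simp⟩ : I01)) z) = z := by
    intro z
    induction z with
    | zero => rw [map_zero, map_zero, map_zero, TensorProduct.tmul_zero, add_zero]
    | add x y hx hy =>
      nth_rw 3 [← hx]
      nth_rw 3 [← hy]
      rw [map_add, map_add, map_add, TensorProduct.tmul_add, add_add_add_comm]
    | tmul f a =>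
      rw [LinearMap.rTensor_tmul, LinearMap.rTensor_tmul]
      have e : (1 : smoothFun I01) ⊗ₜ[ℂ]
          (evalTensor (𝒜 := 𝒜) (evalSmooth (⟨0, by simp⟩ : I01)) (f ⊗ₜ[ℂ] a)) =
          (algebraMap ℂ (smoothFun I01) (evalSmooth (⟨0, by simp⟩ : I01) f)) ⊗ₜ[ℂ] a := by
        rw [Algebra.algebraMap_eq_smul_one, TensorProduct.smul_tmul]
        simp only [evalTensor, AlgHom.comp_apply, Algebra.TensorProduct.map_tmul]
        congr 1
      rw [e, ← TensorProduct.add_tmul, primitive_derivSmooth, sub_add_cancel]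
  have hc : ∀ r, PowerSeries.coeff r w = primitiveSmooth.rTensor 𝒜
      (PowerSeries.coeff r (PowerSeries.X * (Y * w))) +
        1 ⊗ₜ (PowerSeries.coeff r (1 : 𝒜⟦X⟧)) := by
    intro r
    rw [← h, ← h0, derivSeries, PowerSeries.coeff_mk, evalSeries, PowerSeries.coeff_map]
    exact (hpd _).symm
  ext r
  rw [fundamentalSolution, PowerSeries.coeff_mk]
  induction r using Nat.strong_induction_on with
  | _ r ih =>
    rw [hc r]
    cases r with
    | zero => simp [fundamentalCoeff, Algebra.TensorProduct.one_def]
    | succ r =>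
      rw [PowerSeries.coeff_succ_X_mul, fundamentalCoeff, PowerSeries.coeff_mul,
        ← Finset.Nat.sum_antidiagonal_swap, Finset.Nat.sum_antidiagonal_eq_sum_range_succ_mk,
        Finset.sum_range, PowerSeries.coeff_one, if_neg (Nat.succ_ne_zero r),
        TensorProduct.tmul_zero, add_zero]
      congr 1
      refine Finset.sum_congr rfl fun j _ => ?_
      simp [ih j (by omega)]

/-! ## Formal connections and parallel transport -/

/-- A formal connection `∑_i Γ_i dx_i` on `U ⊆ ℝ^N`, with `Γ_i ∈ (C^∞(U, ℂ) ⊗ 𝒜)[[λ]]`. -/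
abbrev FormalConnection {N : ℕ} (U : Set (Fin N → ℝ)) (𝒜 : Type*) [Ring 𝒜] [Algebra ℂ 𝒜] :=
  Fin N → (smoothFun U ⊗[ℂ] 𝒜)⟦X⟧

/-- Smooth paths `[0,1] → U`. -/
structure SmoothPath {N : ℕ} (U : Set (Fin N → ℝ)) where
  toFun : ℝ → Fin N → ℝ
  smooth : ContDiffOn ℝ ∞ toFun I01
  mapsTo : Set.MapsTo toFun I01 U

/-- The `i`-th component `dc_i/ds` of the derivative of a path. -/
def SmoothPath.velocity {N : ℕ} {U : Set (Fin N → ℝ)} (c : SmoothPath U) (i : Fin N) :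
    smoothFun I01 :=
  derivSmooth (smoothRestrict (fun s => (c.toFun s i : ℂ))
    (Complex.ofRealCLM.contDiff.comp_contDiffOn (contDiffOn_pi.1 c.smooth i)))

/-- `Γ^{(c)} = ∑_i (Γ_i ∘ c) dc_i/ds`. -/
def FormalConnection.alongPath {N : ℕ} {U : Set (Fin N → ℝ)} (Γ : FormalConnection U 𝒜)
    (c : SmoothPath U) : (smoothFun I01 ⊗[ℂ] 𝒜)⟦X⟧ :=
  ∑ i, PowerSeries.map (Algebra.TensorProduct.map
      (compSmooth c.toFun c.smooth c.mapsTo) (AlgHom.id ℂ 𝒜)).toRingHom (Γ i) *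
    PowerSeries.C (c.velocity i ⊗ₜ[ℂ] (1 : 𝒜))

/-- The parallel transport `W_{10}^{(c)}` along `c`, with respect to the connection `Γ`. -/
def parallelTransport {N : ℕ} {U : Set (Fin N → ℝ)} (Γ : FormalConnection U 𝒜)
    (c : SmoothPath U) : 𝒜⟦X⟧ :=
  evalSeries ⟨1, by simp⟩ (fundamentalSolution (Γ.alongPath c))

/-- The pull-back `(Θ^*Γ)_j = ∑_i (Γ_i ∘ Θ) ∂Θ_i/∂x_j` by a smooth map `Θ : V → U`, `V` open. -/
def FormalConnection.pullback {N M : ℕ} {U : Set (Fin N → ℝ)} {V : Set (Fin M → ℝ)}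
    (Γ : FormalConnection U 𝒜) (Θ : (Fin M → ℝ) → Fin N → ℝ) (hV : IsOpen V)
    (hΘ : ContDiffOn ℝ ∞ Θ V) (hVU : Set.MapsTo Θ V U) : FormalConnection V 𝒜 := fun j =>
  ∑ i, PowerSeries.map (Algebra.TensorProduct.map
      (compSmooth Θ hΘ hVU) (AlgHom.id ℂ 𝒜)).toRingHom (Γ i) *
    PowerSeries.C (smoothRestrict (fun x => ((fderiv ℝ Θ x (Pi.single j 1) i : ℝ) : ℂ))
      (Complex.ofRealCLM.contDiff.comp_contDiffOn (contDiffOn_pi.1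
        (((contDiffOn_infty_iff_fderiv_of_isOpen hV).1 hΘ).2.clm_apply contDiffOn_const) i))
      ⊗ₜ[ℂ] (1 : 𝒜))

/-- The affine path from `ξ` to `η` in a convex set. -/
def affinePath {N : ℕ} {U : Set (Fin N → ℝ)} (hU : Convex ℝ U) (ξ η : U) : SmoothPath U where
  toFun s := (1 - s) • (ξ : Fin N → ℝ) + s • (η : Fin N → ℝ)
  smooth := by fun_prop
  mapsTo := fun s hs => hU ξ.2 η.2 (by linarith [hs.2]) hs.1 (by ring)

/-! ## The Knizhnik--Zamolodchikov connection -/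

/-- The infinitesimal braid relations (only the `A i j` with `i ≠ j` matter). -/
structure InfinitesimalBraid {n : ℕ} (A : Fin n → Fin n → 𝒜) : Prop where
  symm : ∀ i j, i ≠ j → A i j = A j i
  three : ∀ i j k, i ≠ j → i ≠ k → j ≠ k → (A i j + A i k) * A j k = A j k * (A i j + A i k)
  four : ∀ i j k l, i ≠ j → i ≠ k → i ≠ l → j ≠ k → j ≠ l → k ≠ l →
    A i j * A k l = A k l * A i j

/-- The ordered configurations of `n` distinct points on the real line, i.e. the real points of the
configuration space of `n` distinct points in the complex plane. -/
def realConfig (n : ℕ) : Set (Fin n → ℝ) := {x | ∀ i j, i ≠ j → x i ≠ x j}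

/-- The function `1 / (x_i - x_j)`. -/
def invDiff {n : ℕ} (i j : Fin n) (hij : i ≠ j) : smoothFun (realConfig n) :=
  smoothRestrict (fun x => (((x i - x j)⁻¹ : ℝ) : ℂ))
    (Complex.ofRealCLM.contDiff.comp_contDiffOn (ContDiffOn.inv (by fun_prop)
      fun _ hx => sub_ne_zero.2 (hx i j hij)))

/-- The formal KZ connection `∑_{i<j} A_{ij} / (x_i - x_j) (dx_i - dx_j)`, at real points. -/
def kzConnection {n : ℕ} (A : Fin n → Fin n → 𝒜) : FormalConnection (realConfig n) 𝒜 := fun k =>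
  ∑ p : {p : Fin n × Fin n // p.1 < p.2}, PowerSeries.C
    ((((if p.1.1 = k then 1 else 0) - (if p.1.2 = k then 1 else 0) : ℂ) •
      invDiff p.1.1 p.1.2 p.2.ne) ⊗ₜ[ℂ] A p.1.1 p.1.2)

/-- The open triangle `{(x₂, x₃) | 0 < x₂ < x₃ < 1}`. -/
def triangle : Set (Fin 2 → ℝ) := {x | 0 < x 0 ∧ x 0 < x 1 ∧ x 1 < 1}

theorem isOpen_triangle : IsOpen triangle :=
  (isOpen_lt continuous_const (continuous_apply 0)).inter
    ((isOpen_lt (continuous_apply 0) (continuous_apply 1)).inter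
      (isOpen_lt (continuous_apply 1) continuous_const))

theorem convex_triangle : Convex ℝ triangle := by
  rintro x ⟨h1, h2, h3⟩ y ⟨k1, k2, k3⟩ a b ha hb hab
  have key : ∀ u v : ℝ, 0 < u → 0 < v → 0 < a * u + b * v := by
    intro u v hu hv
    rcases ha.eq_or_lt with rfl | ha
    · have : b = 1 := by linarith
      subst this; linarith
    · have := mul_pos ha hu
      have := mul_nonneg hb hv.le
      linarith
  have e1 := key _ _ h1 k1
  have e2 := key _ _ (sub_pos.2 h2) (sub_pos.2 k2)
  have e3 := key _ _ (sub_pos.2 h3) (sub_pos.2 k3)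
  refine ⟨?_, ?_, ?_⟩ <;> simp only [Pi.add_apply, Pi.smul_apply, smul_eq_mul] <;> nlinarith

/-- The embedding `(x₂, x₃) ↦ (0, x₂, x₃, 1)`. -/
def triangleEmb (x : Fin 2 → ℝ) : Fin 4 → ℝ := ![0, x 0, x 1, 1]

theorem contDiff_triangleEmb : ContDiff ℝ ∞ triangleEmb := by
  rw [contDiff_pi]
  intro i
  fin_cases i <;> simp [triangleEmb] <;> fun_prop

theorem mapsTo_triangleEmb : Set.MapsTo triangleEmb triangle (realConfig 4) := by
  rintro x ⟨h1, h2, h3⟩ i j hij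
  fin_cases i <;> fin_cases j <;> simp_all [triangleEmb] <;> first | positivity | grind

/-- The KZ connection for four points, pulled back to the triangle. -/
def pentagonConnection (A : Fin 4 → Fin 4 → 𝒜) : FormalConnection triangle 𝒜 :=
  (kzConnection A).pullback triangleEmb isOpen_triangle contDiff_triangleEmb.contDiffOn
    mapsTo_triangleEmb

theorem evalTensor_tmul {R : Type*} [Ring R] [Algebra ℂ R] (φ : R →ₐ[ℂ] ℂ) (f : R) (a : 𝒜) :
    evalTensor φ (f ⊗ₜ[ℂ] a) = φ f • a := by
  simp [evalTensor]

theorem fderiv_triangleEmb (x : Fin 2 → ℝ) (j : Fin 2) (i : Fin 4) :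
    fderiv ℝ triangleEmb x (Pi.single j 1) i =
      (![0, if j = 0 then 1 else 0, if j = 1 then 1 else 0, 0] : Fin 4 → ℝ) i := by
  have h : HasFDerivAt triangleEmb (ContinuousLinearMap.pi
      ![0, ContinuousLinearMap.proj (R := ℝ) (φ := fun _ : Fin 2 => ℝ) 0,
        ContinuousLinearMap.proj (R := ℝ) (φ := fun _ : Fin 2 => ℝ) 1, 0]) x := by
    rw [hasFDerivAt_pi]
    intro i
    fin_cases i
    · exact hasFDerivAt_const _ _
    · exact (ContinuousLinearMap.proj (R := ℝ) (φ := fun _ : Fin 2 => ℝ) 0).hasFDerivAt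
    · exact (ContinuousLinearMap.proj (R := ℝ) (φ := fun _ : Fin 2 => ℝ) 1).hasFDerivAt
    · exact hasFDerivAt_const _ _
  rw [h.fderiv]
  fin_cases i <;> simp [Pi.single_apply, eq_comm]

theorem eval_kzConnection (A : Fin 4 → Fin 4 → 𝒜) (x : triangle) (k : Fin 4) :
    PowerSeries.map (evalTensor (𝒜 := 𝒜) (evalSmooth x)).toRingHom
      (PowerSeries.map (Algebra.TensorProduct.map (compSmooth triangleEmb
        contDiff_triangleEmb.contDiffOn mapsTo_triangleEmb) (AlgHom.id ℂ 𝒜)).toRingHom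
          (kzConnection A k)) =
      PowerSeries.C (∑ p : Fin 4 × Fin 4, if p.1 < p.2 then
        (((if p.1 = k then 1 else 0) - (if p.2 = k then 1 else 0) : ℂ) *
          (((triangleEmb x p.1 - triangleEmb x p.2)⁻¹ : ℝ) : ℂ)) • A p.1 p.2 else 0) := by
  rw [← Finset.sum_filter, Finset.sum_subtype (p := fun p : Fin 4 × Fin 4 => p.1 < p.2) _ (by simp),
    kzConnection, map_sum, map_sum, map_sum]
  refine Finset.sum_congr rfl fun p _ => ?_
  rw [PowerSeries.map_C, PowerSeries.map_C]
  congr 1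

theorem eval_pentagonConnection (A : Fin 4 → Fin 4 → 𝒜) (x : triangle) (j : Fin 2) :
    PowerSeries.map (evalTensor (𝒜 := 𝒜) (evalSmooth x)).toRingHom (pentagonConnection A j) =
      ∑ k, PowerSeries.C (∑ p : Fin 4 × Fin 4, if p.1 < p.2 then
        (((if p.1 = k then 1 else 0) - (if p.2 = k then 1 else 0) : ℂ) *
          (((triangleEmb x p.1 - triangleEmb x p.2)⁻¹ : ℝ) : ℂ)) • A p.1 p.2 else 0) *
      PowerSeries.C ((((![0, if j = 0 then 1 else 0, if j = 1 then 1 else 0, 0] : Fin 4 → ℝ) k : ℝ) : ℂ) •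
        (1 : 𝒜)) := by
  rw [pentagonConnection, FormalConnection.pullback, map_sum]
  refine Finset.sum_congr rfl fun k _ => ?_
  rw [map_mul, eval_kzConnection, PowerSeries.map_C]
  congr 2
  change evalTensor _ (_ ⊗ₜ[ℂ] _) = _
  rw [evalTensor_tmul, ← fderiv_triangleEmb x]
  rfl

/-- In coordinates, the first component of the pulled-back connection is
`A₁₂ / x₂ + A₂₃ / (x₂ - x₃) + A₂₄ / (x₂ - 1)`. -/
theorem pentagonConnection_zero (A : Fin 4 → Fin 4 → 𝒜) (x : triangle) :
    PowerSeries.map (evalTensor (𝒜 := 𝒜) (evalSmooth x)).toRingHom (pentagonConnection A 0) =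
      PowerSeries.C ((((x.1 0)⁻¹ : ℝ) : ℂ) • A 0 1 + (((x.1 0 - x.1 1)⁻¹ : ℝ) : ℂ) • A 1 2 +
        (((x.1 0 - 1)⁻¹ : ℝ) : ℂ) • A 1 3) := by
  rw [eval_pentagonConnection]
  simp [Fin.sum_univ_four, Fintype.sum_prod_type, triangleEmb]
  abel_nf

/-- In coordinates, the second component of the pulled-back connection is
`A₁₃ / x₃ - A₂₃ / (x₂ - x₃) + A₃₄ / (x₃ - 1)`. -/
theorem pentagonConnection_one (A : Fin 4 → Fin 4 → 𝒜) (x : triangle) :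
    PowerSeries.map (evalTensor (𝒜 := 𝒜) (evalSmooth x)).toRingHom (pentagonConnection A 1) =
      PowerSeries.C ((((x.1 1)⁻¹ : ℝ) : ℂ) • A 0 2 - (((x.1 0 - x.1 1)⁻¹ : ℝ) : ℂ) • A 1 2 +
        (((x.1 1 - 1)⁻¹ : ℝ) : ℂ) • A 2 3) := by
  rw [eval_pentagonConnection]
  simp [Fin.sum_univ_four, Fintype.sum_prod_type, triangleEmb]
  abel_nf

/-! ## The range of the small parameter, harmless group terms -/

/-- The interval `]0, 1/4]`. -/
abbrev J : Set ℝ := Set.Ioc 0 (1 / 4)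

/-- The map `δ ↦ δ²` of `]0, 1/4]`. -/
def sqJ (δ : J) : J :=
  ⟨(δ : ℝ) ^ 2, pow_pos δ.2.1 2, by nlinarith [δ.2.1, δ.2.2]⟩

/-- The value at `δ` of an element of `(Fun(]0,1/4], ℂ) ⊗ 𝒜)[[λ]]`. -/
def evalJ (δ : J) (F : ((J → ℂ) ⊗[ℂ] 𝒜)⟦X⟧) : 𝒜⟦X⟧ :=
  PowerSeries.map (evalTensor (𝒜 := 𝒜) (Pi.evalAlgHom ℂ (fun _ : J => ℂ) δ)).toRingHom F

/-- Harmless elements: with respect to every norm on the complex vector space `𝒜` (which need not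
be submultiplicative), each coefficient is bounded by a positive power of `δ`. -/
def IsHarmless (F : ((J → ℂ) ⊗[ℂ] 𝒜)⟦X⟧) : Prop :=
  ∀ ν : Seminorm ℂ 𝒜, (∀ x, ν x = 0 → x = 0) → ∀ r : ℕ, ∃ C β : ℝ, 0 ≤ C ∧ 0 < β ∧
    ∀ δ : J, ν (PowerSeries.coeff r (evalJ δ F)) ≤ C * (δ : ℝ) ^ β

/-- The harmless group terms, `1 + λ F` with `F` harmless. -/
def harmlessGroup (𝒜 : Type*) [Ring 𝒜] [Algebra ℂ 𝒜] : Set ((J → ℂ) ⊗[ℂ] 𝒜)⟦X⟧ :=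
  {H | ∃ F, IsHarmless F ∧ H = 1 + PowerSeries.X * F}

/-! ## The terms `e^{λ c B}` and `ψ_ε(B, A)` -/

/-- The formal exponential `e^{λ c B}` for a number `c`. -/
def formalExp (c : ℝ) (B : 𝒜) : 𝒜⟦X⟧ :=
  PowerSeries.mk fun n => (((c ^ n / n.factorial : ℝ) : ℂ)) • B ^ n

/-- The open unit interval, as a subset of `ℝ^1`. -/
def unitOpen : Set (Fin 1 → ℝ) := {x | 0 < x 0 ∧ x 0 < 1}

/-- The connection `Γ(B, A) = (A / x + B / (x - 1)) dx` on `]0, 1[`. -/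
def twoPointConnection (B A : 𝒜) : FormalConnection unitOpen 𝒜 := fun _ =>
  PowerSeries.C
    (smoothRestrict (fun x : Fin 1 → ℝ => (((x 0)⁻¹ : ℝ) : ℂ))
        (Complex.ofRealCLM.contDiff.comp_contDiffOn (ContDiffOn.inv (by fun_prop)
          fun _ hx => hx.1.ne')) ⊗ₜ[ℂ] A +
      smoothRestrict (fun x : Fin 1 → ℝ => (((x 0 - 1)⁻¹ : ℝ) : ℂ))
        (Complex.ofRealCLM.contDiff.comp_contDiffOn (ContDiffOn.inv (by fun_prop)
          fun _ hx => (sub_neg.2 hx.2).ne)) ⊗ₜ[ℂ] B)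

/-- The exponential half-path `s ↦ 1 - (1/2) e^{ln(2ε) s}` from `1/2` to `1 - ε`. -/
def halfPath (ε : J) : SmoothPath unitOpen where
  toFun s := fun _ => 1 - 1 / 2 * Real.exp (Real.log (2 * ε) * s)
  smooth := by fun_prop
  mapsTo := fun s hs => by
    have h1 : Real.log (2 * ε) ≤ 0 :=
      Real.log_nonpos (by linarith [ε.2.1]) (by linarith [ε.2.2])
    have h2 : Real.exp (Real.log (2 * ε) * s) ≤ 1 :=
      Real.exp_le_one_iff.2 (mul_nonpos_of_nonpos_of_nonneg h1 hs.1)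
    have h3 := Real.exp_pos (Real.log (2 * ε) * s)
    constructor <;> linarith

/-- `ψ_ε(B, A)`, defined by `W_{10} = e^{λ ln(ε) B} ψ_ε(B, A)` for the parallel transport of
`Γ(B, A)` along the half-path from `1/2` to `1 - ε`. -/
def psiSeries (ε : J) (B A : 𝒜) : 𝒜⟦X⟧ :=
  formalExp (-Real.log ε) B * parallelTransport (twoPointConnection B A) (halfPath ε)

theorem constantCoeff_psiSeries (ε : J) (B A : 𝒜) :
    PowerSeries.constantCoeff (psiSeries ε B A) = 1 := by
  rw [psiSeries, map_mul, ← PowerSeries.coeff_zero_eq_constantCoeff_apply,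
    ← PowerSeries.coeff_zero_eq_constantCoeff_apply, formalExp, PowerSeries.coeff_mk,
    parallelTransport, evalSeries, PowerSeries.coeff_map, fundamentalSolution,
    PowerSeries.coeff_mk]
  simp [fundamentalCoeff]

/-- `ψ_ε(B, A)` as an invertible element of `𝒜[[λ]]`. -/
def psi (ε : J) (B A : 𝒜) : (𝒜⟦X⟧)ˣ where
  val := psiSeries ε B A
  inv := PowerSeries.invOfUnit (psiSeries ε B A) 1
  val_inv := PowerSeries.mul_invOfUnit _ 1 (constantCoeff_psiSeries ε B A)
  inv_val := PowerSeries.invOfUnit_mul _ 1 (constantCoeff_psiSeries ε B A)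

/-! ## The pentagon -/

/-- The five vertices `p₁, …, p₅` (indexed from `0`) of the pentagon, the Drinfeld zones. -/
def vertex (δ : J) : Fin 5 → Fin 2 → ℝ :=
  ![![(δ : ℝ) ^ 2, δ],
    ![(δ : ℝ) - δ ^ 2, δ],
    ![1 - (δ : ℝ), 1 - δ + δ ^ 2],
    ![1 - (δ : ℝ), 1 - δ ^ 2],
    ![(δ : ℝ) ^ 2, 1 - δ ^ 2]]

theorem vertex_mem (δ : J) (i : Fin 5) : vertex δ i ∈ triangle := by
  have h1 := δ.2.1
  have h2 := δ.2.2
  fin_cases i <;> refine ⟨?_, ?_, ?_⟩ <;> simp [vertex] <;> nlinarith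

/-- The affine path from `p_i` to `p_j`. -/
def edge (δ : J) (i j : Fin 5) : SmoothPath triangle :=
  affinePath convex_triangle ⟨vertex δ i, vertex_mem δ i⟩ ⟨vertex δ j, vertex_mem δ j⟩

end

end KZPentagon

open KZPentagon

namespace KZPentagon

noncomputable section

/-! ## Growth of functions of the small parameter -/

/-! Along an affine path in the triangle, the connection form is a sum of logarithmic derivatives of
the five positive affine functions `x₂`, `x₃`, `x₃ - x₂`, `1 - x₂`, `1 - x₃`, each multiplied by a
residue (`pentagonConnection_alongPath`). A logarithmic derivative ignores constant factors. On each
edge there is an affine parameter `y` running from `a` to `1 - b`, with `a` and `b` equal to `δ` or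
`δ²`, such that each of the five functions is proportional to `y`, `1 - y` or `1`, up to a relative
error of order `δ`. Replacing the functions by these models gives the form of `Γ(Y, X)`, where `X`
and `Y` are the sums of the residues attached to `y` and to `1 - y`.

The model transport is known exactly once it is cut at `y = 1/2`. The piece from `1/2` to `1 - b` is
a reparametrized half-path and gives `e^{λ ln(b) Y} ψ_b(Y, X)` (`modelForm_transport_right`). The
reflection `y ↦ 1 - y` exchanges the residues, so the piece from `a` to `1/2` is the inverse of a
half-path transport for `Γ(X, Y)` and gives `ψ_a(X, Y)⁻¹ e^{-λ ln(a) X}`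
(`modelForm_transport_left`).

The cost of the replacement is measured in `L¹([0,1])`. The model form has norm `O(1 + |ln δ|)`,
which grows more slowly than every negative power of `δ`. The error is governed by Wronskians and
has norm `O(δ (1 + |ln δ|))` (`integralSeminorm_logDer_sub_le`). Each coefficient of a solution is
an iterated integral with finitely many factors, so it changes only by a term bounded by a positive
power of `δ`. Conjugation by series of moderate growth preserves such bounds, so the change can be
placed at `y = 1/2` as a harmless group term (`exists_harmless_comparison`).
`parallelTransport_edge` combines these facts; what remains for each edge are polynomial
inequalities in `δ`.

No multiplicative norm on `𝒜` is available. All estimates therefore concern the function factors of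
finite sums of tensors `f ⊗ a`, and a norm on `𝒜` enters only at the end, in
`isHarmless_of_coeff_mem`. -/

theorem J_pos (δ : J) : 0 < (δ : ℝ) := δ.2.1

theorem J_le_one (δ : J) : (δ : ℝ) ≤ 1 := δ.2.2.trans (by norm_num)

/-- The functions on `]0, 1/4]` that grow more slowly than every negative power of `δ`. -/
def moderate : Submodule ℝ (J → ℝ) where
  carrier := {g | ∀ β : ℝ, 0 < β → ∃ C : ℝ, 0 ≤ C ∧ ∀ δ : J, |g δ| ≤ C * (δ : ℝ) ^ (-β)}
  zero_mem' := fun β _ => ⟨0, le_rfl, fun δ => by simp⟩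
  add_mem' := by
    intro f g hf hg β hβ
    obtain ⟨C, hC, h⟩ := hf β hβ
    obtain ⟨D, hD, k⟩ := hg β hβ
    refine ⟨C + D, add_nonneg hC hD, fun δ => ?_⟩
    rw [add_mul]
    exact (abs_add_le _ _).trans (add_le_add (h δ) (k δ))
  smul_mem' := by
    intro c f hf β hβ
    obtain ⟨C, hC, h⟩ := hf β hβ
    refine ⟨|c| * C, by positivity, fun δ => ?_⟩
    rw [Pi.smul_apply, smul_eq_mul, abs_mul, mul_assoc]
    exact mul_le_mul_of_nonneg_left (h δ) (abs_nonneg c)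

/-- The functions on `]0, 1/4]` that are bounded by a positive power of `δ`. -/
def decaying : Submodule ℝ (J → ℝ) where
  carrier := {g | ∃ β : ℝ, 0 < β ∧ ∃ C : ℝ, 0 ≤ C ∧ ∀ δ : J, |g δ| ≤ C * (δ : ℝ) ^ β}
  zero_mem' := ⟨1, one_pos, 0, le_rfl, fun δ => by simp⟩
  add_mem' := by
    rintro f g ⟨β, hβ, C, hC, h⟩ ⟨γ, hγ, D, hD, k⟩
    refine ⟨min β γ, lt_min hβ hγ, C + D, add_nonneg hC hD, fun δ => ?_⟩
    rw [add_mul]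
    refine (abs_add_le _ _).trans (add_le_add ((h δ).trans ?_) ((k δ).trans ?_))
    · exact mul_le_mul_of_nonneg_left
        (Real.rpow_le_rpow_of_exponent_ge (J_pos δ) (J_le_one δ) (min_le_left _ _)) hC
    · exact mul_le_mul_of_nonneg_left
        (Real.rpow_le_rpow_of_exponent_ge (J_pos δ) (J_le_one δ) (min_le_right _ _)) hD
  smul_mem' := by
    rintro c f ⟨β, hβ, C, hC, h⟩
    refine ⟨β, hβ, |c| * C, by positivity, fun δ => ?_⟩
    rw [Pi.smul_apply, smul_eq_mul, abs_mul, mul_assoc]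
    exact mul_le_mul_of_nonneg_left (h δ) (abs_nonneg c)

theorem const_mem_moderate (c : ℝ) : (fun _ => c) ∈ moderate := fun β hβ =>
  ⟨|c|, abs_nonneg c, fun δ => le_mul_of_one_le_right (abs_nonneg c)
    (Real.one_le_rpow_of_pos_of_le_one_of_nonpos (J_pos δ) (J_le_one δ) (by linarith))⟩

theorem log_mem_moderate : (fun δ : J => Real.log δ) ∈ moderate := by
  intro β hβ
  refine ⟨1 / β, by positivity, fun δ => ?_⟩
  have h := Real.abs_log_mul_self_rpow_lt δ β (J_pos δ) (J_le_one δ) hβ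
  have hp := Real.rpow_pos_of_pos (J_pos δ) β
  rw [abs_mul, abs_of_pos hp] at h
  rw [Real.rpow_neg (J_pos δ).le, ← div_eq_mul_inv, le_div_iff₀ hp]
  exact h.le

theorem decaying_le_moderate : decaying ≤ moderate := by
  rintro g ⟨β, hβ, C, hC, h⟩ γ hγ
  refine ⟨C, hC, fun δ => (h δ).trans (mul_le_mul_of_nonneg_left ?_ hC)⟩
  exact Real.rpow_le_rpow_of_exponent_ge (J_pos δ) (J_le_one δ) (by linarith)

theorem id_mem_decaying : (fun δ : J => (δ : ℝ)) ∈ decaying :=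
  ⟨1, one_pos, 1, zero_le_one, fun δ => by simp [abs_of_pos (J_pos δ)]⟩

theorem moderate_mul_moderate {f g : J → ℝ} (hf : f ∈ moderate) (hg : g ∈ moderate) :
    f * g ∈ moderate := by
  intro β hβ
  obtain ⟨C, hC, h⟩ := hf (β / 2) (by positivity)
  obtain ⟨D, hD, k⟩ := hg (β / 2) (by positivity)
  refine ⟨C * D, mul_nonneg hC hD, fun δ => ?_⟩
  rw [Pi.mul_apply, abs_mul, show -β = -(β / 2) + -(β / 2) by ring,
    Real.rpow_add (J_pos δ), mul_mul_mul_comm]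
  exact mul_le_mul (h δ) (k δ) (abs_nonneg _)
    (mul_nonneg hC (Real.rpow_nonneg (J_pos δ).le _))

/-- Half of the decay exponent of `g` absorbs the growth of `f`; the other half survives. This makes
`decaying` an ideal relative to `moderate`. -/
theorem moderate_mul_decaying {f g : J → ℝ} (hf : f ∈ moderate) (hg : g ∈ decaying) :
    f * g ∈ decaying := by
  obtain ⟨β, hβ, D, hD, k⟩ := hg
  obtain ⟨C, hC, h⟩ := hf (β / 2) (by positivity)
  refine ⟨β / 2, by positivity, C * D, mul_nonneg hC hD, fun δ => ?_⟩
  have e : (δ : ℝ) ^ (β / 2) = (δ : ℝ) ^ (-(β / 2)) * (δ : ℝ) ^ β := by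
    rw [← Real.rpow_add (J_pos δ)]
    congr 1
    ring
  rw [Pi.mul_apply, abs_mul, e, mul_mul_mul_comm]
  exact mul_le_mul (h δ) (k δ) (abs_nonneg _)
    (mul_nonneg hC (Real.rpow_nonneg (J_pos δ).le _))

theorem decaying_mul_moderate {f g : J → ℝ} (hf : f ∈ decaying) (hg : g ∈ moderate) :
    f * g ∈ decaying :=
  mul_comm g f ▸ moderate_mul_decaying hg hf

/-! ### Families in a seminormed space -/

/-- The families `f : J → E` whose seminorms are bounded by a function in `G`. -/
def boundedFamily {E : Type*} [AddCommGroup E] [Module ℂ E] (ν : Seminorm ℂ E)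
    (G : Submodule ℝ (J → ℝ)) : Submodule ℂ (J → E) where
  carrier := {f | ∃ g ∈ G, ∀ δ, ν (f δ) ≤ g δ}
  zero_mem' := ⟨0, G.zero_mem, fun δ => by simp⟩
  add_mem' := by
    rintro f f' ⟨g, hg, h⟩ ⟨g', hg', h'⟩
    exact ⟨g + g', G.add_mem hg hg', fun δ =>
      (map_add_le_add ν _ _).trans (add_le_add (h δ) (h' δ))⟩
  smul_mem' := by
    rintro c f ⟨g, hg, h⟩
    refine ⟨‖c‖ • g, G.smul_mem _ hg, fun δ => ?_⟩
    rw [Pi.smul_apply, map_smul_eq_mul, Pi.smul_apply, smul_eq_mul]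
    exact mul_le_mul_of_nonneg_left (h δ) (norm_nonneg c)

/-- A product estimate for seminorms gives one for families. -/
theorem boundedFamily_mul {E : Type*} [Ring E] [Algebra ℂ E] {ν₁ ν₂ ν₃ : Seminorm ℂ E}
    {G₁ G₂ G₃ : Submodule ℝ (J → ℝ)} (hν : ∀ x y, ν₃ (x * y) ≤ ν₁ x * ν₂ y)
    (hG : ∀ g₁ ∈ G₁, ∀ g₂ ∈ G₂, g₁ * g₂ ∈ G₃) {f₁ f₂ : J → E}
    (h₁ : f₁ ∈ boundedFamily ν₁ G₁) (h₂ : f₂ ∈ boundedFamily ν₂ G₂) :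
    f₁ * f₂ ∈ boundedFamily ν₃ G₃ := by
  obtain ⟨g₁, m₁, k₁⟩ := h₁
  obtain ⟨g₂, m₂, k₂⟩ := h₂
  refine ⟨g₁ * g₂, hG _ m₁ _ m₂, fun δ => (hν _ _).trans ?_⟩
  exact mul_le_mul (k₁ δ) (k₂ δ) (apply_nonneg _ _) ((apply_nonneg _ _).trans (k₁ δ))

theorem boundedFamily_map {E F : Type*} [AddCommGroup E] [Module ℂ E] [AddCommGroup F]
    [Module ℂ F] {ν : Seminorm ℂ E} {μ : Seminorm ℂ F} {G : Submodule ℝ (J → ℝ)}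
    {f : J → E} (hf : f ∈ boundedFamily ν G) (f' : J → F) (h : ∀ δ, μ (f' δ) ≤ ν (f δ)) :
    f' ∈ boundedFamily μ G := by
  obtain ⟨g, m, k⟩ := hf
  exact ⟨g, m, fun δ => (h δ).trans (k δ)⟩

/-! ## Tensors and power series with restricted coefficients -/

variable {𝒜 : Type*} [Ring 𝒜] [Algebra ℂ 𝒜]

/-- The span of the tensors `f ⊗ a` with `f ∈ M`. -/
def tensorSpan {R : Type*} [Ring R] [Algebra ℂ R] (𝒜 : Type*) [Ring 𝒜] [Algebra ℂ 𝒜]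
    (M : Submodule ℂ R) : Submodule ℂ (R ⊗[ℂ] 𝒜) :=
  Submodule.map₂ (TensorProduct.mk ℂ R 𝒜) M ⊤

section

variable {R : Type*} [Ring R] [Algebra ℂ R]

theorem tmul_mem_tensorSpan {M : Submodule ℂ R} {f : R} (hf : f ∈ M) (a : 𝒜) :
    f ⊗ₜ[ℂ] a ∈ tensorSpan 𝒜 M :=
  Submodule.apply_mem_map₂ _ hf Submodule.mem_top

theorem tensorSpan_le {M : Submodule ℂ R} {P : Submodule ℂ (R ⊗[ℂ] 𝒜)}
    (h : ∀ f ∈ M, ∀ a : 𝒜, f ⊗ₜ[ℂ] a ∈ P) : tensorSpan 𝒜 M ≤ P :=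
  Submodule.map₂_le.2 fun f hf a _ => h f hf a

theorem one_mem_tensorSpan {M : Submodule ℂ R} (h : (1 : R) ∈ M) :
    (1 : R ⊗[ℂ] 𝒜) ∈ tensorSpan 𝒜 M :=
  tmul_mem_tensorSpan h 1

/-- Since `(f ⊗ a)(g ⊗ b) = fg ⊗ ab`, only the function factors have to be controlled. This is what
makes product estimates possible without a norm on `𝒜`. -/
theorem mul_mem_tensorSpan {M N K : Submodule ℂ R} (h : ∀ f ∈ M, ∀ g ∈ N, f * g ∈ K)
    {x y : R ⊗[ℂ] 𝒜} (hx : x ∈ tensorSpan 𝒜 M) (hy : y ∈ tensorSpan 𝒜 N) :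
    x * y ∈ tensorSpan 𝒜 K := by
  have h1 : tensorSpan 𝒜 M ≤ (tensorSpan 𝒜 K).comap (LinearMap.mulRight ℂ y) := by
    refine tensorSpan_le fun f hf a => ?_
    have h2 : tensorSpan 𝒜 N ≤ (tensorSpan 𝒜 K).comap (LinearMap.mulLeft ℂ (f ⊗ₜ[ℂ] a)) := by
      refine tensorSpan_le fun g hg b => ?_
      rw [Submodule.mem_comap, LinearMap.mulLeft_apply, Algebra.TensorProduct.tmul_mul_tmul]
      exact tmul_mem_tensorSpan (h f hf g hg) _
    exact h2 hy
  exact h1 hx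

theorem rTensor_mem_tensorSpan {R' : Type*} [Ring R'] [Algebra ℂ R'] {M : Submodule ℂ R}
    {N : Submodule ℂ R'} (L : R →ₗ[ℂ] R') (h : ∀ f ∈ M, L f ∈ N) {x : R ⊗[ℂ] 𝒜}
    (hx : x ∈ tensorSpan 𝒜 M) : L.rTensor 𝒜 x ∈ tensorSpan 𝒜 N := by
  have h1 : tensorSpan 𝒜 M ≤ (tensorSpan 𝒜 N).comap (L.rTensor 𝒜) :=
    tensorSpan_le fun f hf a => by
      rw [Submodule.mem_comap, LinearMap.rTensor_tmul]
      exact tmul_mem_tensorSpan (h f hf) a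
  exact h1 hx

end

theorem coeff_mul_mem {Q : Type*} [Ring Q] [Algebra ℂ Q] {K₁ K₂ K₃ : Submodule ℂ Q}
    (h : ∀ x ∈ K₁, ∀ y ∈ K₂, x * y ∈ K₃) {F G : Q⟦X⟧}
    (hF : ∀ r, PowerSeries.coeff r F ∈ K₁) (hG : ∀ r, PowerSeries.coeff r G ∈ K₂) (r : ℕ) :
    PowerSeries.coeff r (F * G) ∈ K₃ := by
  rw [PowerSeries.coeff_mul]
  exact Submodule.sum_mem _ fun p _ => h _ (hF _) _ (hG _)

/-- The recursion for the coefficients of the inverse uses only sums, products and signs, so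
inverses of series of moderate growth are again of moderate growth. -/
theorem coeff_invOfUnit_mem {Q : Type*} [Ring Q] [Algebra ℂ Q] {K : Submodule ℂ Q}
    (h1 : (1 : Q) ∈ K) (h : ∀ x ∈ K, ∀ y ∈ K, x * y ∈ K) {F : Q⟦X⟧}
    (hF : ∀ r, PowerSeries.coeff r F ∈ K) (r : ℕ) :
    PowerSeries.coeff r (PowerSeries.invOfUnit F 1) ∈ K := by
  induction r using Nat.strong_induction_on with
  | _ r ih =>
    rw [PowerSeries.coeff_invOfUnit]
    split_ifs
    · simpa using h1
    · rw [inv_one, Units.val_one, neg_one_mul]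
      refine K.neg_mem (Submodule.sum_mem _ fun p _ => ?_)
      split_ifs with hp
      · exact h _ (hF _) _ (ih _ hp)
      · exact K.zero_mem

/-! ## Families of numbers -/

/-- The families of numbers bounded by a function in `G`. -/
abbrev boundedScalar (G : Submodule ℝ (J → ℝ)) : Submodule ℂ (J → ℂ) :=
  boundedFamily (normSeminorm ℂ ℂ) G

theorem boundedScalar_mul {G₁ G₂ G₃ : Submodule ℝ (J → ℝ)}
    (hG : ∀ g₁ ∈ G₁, ∀ g₂ ∈ G₂, g₁ * g₂ ∈ G₃) :
    ∀ f ∈ boundedScalar G₁, ∀ g ∈ boundedScalar G₂, f * g ∈ boundedScalar G₃ :=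
  fun _ hf _ hg => boundedFamily_mul (fun x y => norm_mul_le x y) hG hf hg

theorem one_mem_boundedScalar : (1 : J → ℂ) ∈ boundedScalar moderate :=
  ⟨fun _ => 1, const_mem_moderate 1, fun _ => by simp⟩

/-- For a single tensor, `ν (f(δ) a) = |f(δ)| ν(a)`, whatever the seminorm `ν`; finite sums follow
by linearity. -/
theorem isHarmless_of_coeff_mem {F : ((J → ℂ) ⊗[ℂ] 𝒜)⟦X⟧}
    (hF : ∀ r, PowerSeries.coeff r F ∈ tensorSpan 𝒜 (boundedScalar decaying)) :
    IsHarmless F := by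
  intro ν _ r
  let ev (δ : J) : (J → ℂ) ⊗[ℂ] 𝒜 →ₐ[ℂ] 𝒜 := evalTensor (Pi.evalAlgHom ℂ (fun _ : J => ℂ) δ)
  let evAll : (J → ℂ) ⊗[ℂ] 𝒜 →ₗ[ℂ] (J → 𝒜) := LinearMap.pi fun δ => (ev δ).toLinearMap
  have h : tensorSpan 𝒜 (boundedScalar decaying) ≤ (boundedFamily ν decaying).comap evAll := by
    refine tensorSpan_le ?_
    rintro f ⟨g, hg, k⟩ a
    refine ⟨ν a • g, decaying.smul_mem _ hg, fun δ => ?_⟩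
    change ν (evalTensor _ (f ⊗ₜ[ℂ] a)) ≤ ν a * g δ
    rw [evalTensor_tmul, map_smul_eq_mul, mul_comm]
    exact mul_le_mul_of_nonneg_left (k δ) (apply_nonneg _ _)
  obtain ⟨g, ⟨β, hβ, C, hC, hb⟩, k⟩ := h (hF r)
  refine ⟨C, β, hC, hβ, fun δ => ?_⟩
  rw [evalJ, PowerSeries.coeff_map]
  exact (k δ).trans ((le_abs_self _).trans (hb δ))

/-! ## Seminorms on the smooth functions on `[0,1]` -/

theorem continuous_smoothFun (f : smoothFun I01) : Continuous f.1 := by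
  have h := (contDiffOn_extendI01 f).continuousOn
  rw [continuousOn_iff_continuous_domRestrict] at h
  exact h.congr fun y => extendI01_apply _ y

theorem continuous_extendI01 (f : smoothFun I01) : Continuous (extendI01 f.1) :=
  (continuous_smoothFun f).Icc_extend'

/-- A smooth function on `[0,1]` as a continuous function. -/
def toContinuousMap : smoothFun I01 →ₗ[ℂ] C(I01, ℂ) where
  toFun f := ⟨f.1, continuous_smoothFun f⟩
  map_add' _ _ := rfl
  map_smul' _ _ := rfl

/-- The supremum norm. -/
def supSeminorm : Seminorm ℂ (smoothFun I01) := (normSeminorm ℂ C(I01, ℂ)).comp toContinuousMap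

theorem norm_apply_le_supSeminorm (f : smoothFun I01) (x : I01) : ‖f.1 x‖ ≤ supSeminorm f :=
  (toContinuousMap f).norm_coe_le_norm x

theorem supSeminorm_le {f : smoothFun I01} {C : ℝ} (hC : 0 ≤ C) (h : ∀ x, ‖f.1 x‖ ≤ C) :
    supSeminorm f ≤ C :=
  ((toContinuousMap f).norm_le hC).2 h

theorem norm_extendI01_le (f : smoothFun I01) (t : ℝ) : ‖extendI01 f.1 t‖ ≤ supSeminorm f :=
  norm_apply_le_supSeminorm f _

/-- The norm of `L¹([0,1])`. -/
def integralSeminorm : Seminorm ℂ (smoothFun I01) :=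
  Seminorm.of (fun f => ∫ t in (0 : ℝ)..1, ‖extendI01 f.1 t‖)
    (fun f g => by
      have hf := (continuous_extendI01 f).norm
      have hg := (continuous_extendI01 g).norm
      rw [← intervalIntegral.integral_add (hf.intervalIntegrable _ _) (hg.intervalIntegrable _ _)]
      exact intervalIntegral.integral_mono_on zero_le_one
        ((continuous_extendI01 (f + g)).norm.intervalIntegrable _ _)
        ((hf.add hg).intervalIntegrable _ _) fun t _ => norm_add_le _ _)
    (fun c f => by
      rw [← intervalIntegral.integral_const_mul]
      refine intervalIntegral.integral_congr fun t _ => ?_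
      exact norm_smul c (extendI01 f.1 t))

theorem integralSeminorm_apply (f : smoothFun I01) :
    integralSeminorm f = ∫ t in (0 : ℝ)..1, ‖extendI01 f.1 t‖ := rfl

theorem integralSeminorm_mul_le (f g : smoothFun I01) :
    integralSeminorm (f * g) ≤ integralSeminorm f * supSeminorm g := by
  rw [integralSeminorm_apply, integralSeminorm_apply, ← intervalIntegral.integral_mul_const]
  refine intervalIntegral.integral_mono_on zero_le_one
    ((continuous_extendI01 (f * g)).norm.intervalIntegrable _ _)
    (((continuous_extendI01 f).norm.mul continuous_const).intervalIntegrable _ _) fun t _ => ?_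
  change ‖extendI01 f.1 t * extendI01 g.1 t‖ ≤ _
  rw [norm_mul]
  exact mul_le_mul_of_nonneg_left (norm_extendI01_le g t) (norm_nonneg _)

/-- Together with `integralSeminorm_mul_le` this closes the Picard recursion: an `L¹` coefficient
times a bounded function is in `L¹`, and its primitive is bounded again. A supremum bound on the
form would be useless, since the form has size up to `δ⁻²` near the ends. -/
theorem supSeminorm_primitive_le (f : smoothFun I01) :
    supSeminorm (primitiveSmooth f) ≤ integralSeminorm f := by
  refine supSeminorm_le (apply_nonneg _ _) fun x => ?_
  change ‖∫ t in (0 : ℝ)..x, extendI01 f.1 t‖ ≤ ∫ t in (0 : ℝ)..1, ‖extendI01 f.1 t‖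
  have hf := (continuous_extendI01 f).norm
  refine (intervalIntegral.norm_integral_le_integral_norm x.2.1).trans ?_
  exact intervalIntegral.integral_mono_interval le_rfl x.2.1 x.2.2
    (Filter.Eventually.of_forall fun t => norm_nonneg _) (hf.intervalIntegrable _ _)

/-! ## Families of formal differential equations -/

/-- Families of smooth functions on `[0,1]`. -/
abbrev Family := J → smoothFun I01

/-- The member at `δ` of a family. -/
def member (δ : J) : Family ⊗[ℂ] 𝒜 →ₐ[ℂ] smoothFun I01 ⊗[ℂ] 𝒜 :=
  Algebra.TensorProduct.map (Pi.evalAlgHom ℂ (fun _ : J => smoothFun I01) δ) (AlgHom.id ℂ 𝒜)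

theorem member_tmul (δ : J) (f : Family) (a : 𝒜) : member δ (f ⊗ₜ[ℂ] a) = f δ ⊗ₜ[ℂ] a :=
  Algebra.TensorProduct.map_tmul _ _ _ _

/-- The primitive, member by member. -/
def primitiveFamily : Family →ₗ[ℂ] Family :=
  LinearMap.pi fun δ => primitiveSmooth.comp (LinearMap.proj δ)

theorem member_primitiveFamily (δ : J) (z : Family ⊗[ℂ] 𝒜) :
    member δ (primitiveFamily.rTensor 𝒜 z) = primitiveSmooth.rTensor 𝒜 (member δ z) := by
  induction z with
  | zero => simp
  | add x y hx hy => simp only [map_add, hx, hy]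
  | tmul f a => simp only [LinearMap.rTensor_tmul, member_tmul]; rfl

/-- The coefficients of the fundamental solutions for a family `y`. -/
def familyCoeff (y : Family ⊗[ℂ] 𝒜) : ℕ → Family ⊗[ℂ] 𝒜
  | 0 => 1
  | r + 1 => primitiveFamily.rTensor 𝒜 (y * familyCoeff y r)

/-- A form that is constant in `λ` leaves only the last term of the convolution. -/
theorem fundamentalCoeff_C_succ (y : smoothFun I01 ⊗[ℂ] 𝒜) (r : ℕ) :
    fundamentalCoeff (PowerSeries.C y) (r + 1) =
      primitiveSmooth.rTensor 𝒜 (y * fundamentalCoeff (PowerSeries.C y) r) := by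
  rw [fundamentalCoeff, Finset.sum_eq_single (Fin.last r)]
  · simp
  · intro j _ hj
    have hj' : (j : ℕ) < r := Fin.val_lt_last hj
    rw [PowerSeries.coeff_C, if_neg (by omega), zero_mul]
  · simp

theorem member_familyCoeff (δ : J) (y : Family ⊗[ℂ] 𝒜) (r : ℕ) :
    member δ (familyCoeff y r) = fundamentalCoeff (PowerSeries.C (member δ y)) r := by
  induction r with
  | zero => rw [familyCoeff, map_one, fundamentalCoeff]
  | succ r ih => rw [familyCoeff, member_primitiveFamily, map_mul, ih, fundamentalCoeff_C_succ]

/-- The values of a family at points that depend on `δ`. -/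
def evalFamily (s : J → I01) : Family →ₐ[ℂ] (J → ℂ) :=
  AlgHom.pi fun δ => (evalSmooth (s δ)).comp (Pi.evalAlgHom ℂ (fun _ : J => smoothFun I01) δ)

/-- The values of the fundamental solutions at points that depend on `δ`. -/
def solutionFamily (y : Family ⊗[ℂ] 𝒜) (s : J → I01) : ((J → ℂ) ⊗[ℂ] 𝒜)⟦X⟧ :=
  PowerSeries.mk fun r => (evalFamily s).toLinearMap.rTensor 𝒜 (familyCoeff y r)

theorem evalTensor_evalFamily (s : J → I01) (δ : J) (z : Family ⊗[ℂ] 𝒜) :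
    evalTensor (Pi.evalAlgHom ℂ (fun _ : J => ℂ) δ) ((evalFamily s).toLinearMap.rTensor 𝒜 z) =
      evalTensor (evalSmooth (s δ)) (member δ z) := by
  induction z with
  | zero => simp
  | add x y hx hy => simp only [map_add, hx, hy]
  | tmul f a =>
    rw [LinearMap.rTensor_tmul, member_tmul, evalTensor_tmul, evalTensor_tmul]
    rfl

theorem evalJ_solutionFamily (y : Family ⊗[ℂ] 𝒜) (s : J → I01) (δ : J) :
    evalJ δ (solutionFamily y s) =
      evalSeries (s δ) (fundamentalSolution (PowerSeries.C (member δ y))) := by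
  ext r
  rw [evalJ, PowerSeries.coeff_map, solutionFamily, PowerSeries.coeff_mk, evalSeries,
    PowerSeries.coeff_map, fundamentalSolution, PowerSeries.coeff_mk, ← member_familyCoeff]
  exact evalTensor_evalFamily s δ _

/-! ## Estimates for fundamental solutions -/

theorem primitiveFamily_mem {G : Submodule ℝ (J → ℝ)} :
    ∀ f ∈ boundedFamily integralSeminorm G, primitiveFamily f ∈ boundedFamily supSeminorm G :=
  fun _ hf => boundedFamily_map hf _ fun _ => supSeminorm_primitive_le _

theorem integral_mul_mem {G₁ G₂ G₃ : Submodule ℝ (J → ℝ)}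
    (hG : ∀ g₁ ∈ G₁, ∀ g₂ ∈ G₂, g₁ * g₂ ∈ G₃) {x y : Family ⊗[ℂ] 𝒜}
    (hx : x ∈ tensorSpan 𝒜 (boundedFamily integralSeminorm G₁))
    (hy : y ∈ tensorSpan 𝒜 (boundedFamily supSeminorm G₂)) :
    x * y ∈ tensorSpan 𝒜 (boundedFamily integralSeminorm G₃) :=
  mul_mem_tensorSpan (fun _ hf _ hg => boundedFamily_mul integralSeminorm_mul_le hG hf hg) hx hy

theorem familyCoeff_mem {y : Family ⊗[ℂ] 𝒜}
    (hy : y ∈ tensorSpan 𝒜 (boundedFamily integralSeminorm moderate)) (r : ℕ) :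
    familyCoeff y r ∈ tensorSpan 𝒜 (boundedFamily supSeminorm moderate) := by
  induction r with
  | zero =>
    refine one_mem_tensorSpan ⟨fun _ => 1, const_mem_moderate 1, fun δ => ?_⟩
    exact supSeminorm_le zero_le_one fun x => by simp
  | succ r ih =>
    exact rTensor_mem_tensorSpan _ primitiveFamily_mem
      (integral_mul_mem (fun _ h _ k => moderate_mul_moderate h k) hy ih)

/-- If `c` is the old coefficient and `c + d` the new one, then `(y + p)(c + d) - y c = y d + (p d +
p c)`, and every term on the right has a decaying factor. -/
theorem exists_familyCoeff_add {y p : Family ⊗[ℂ] 𝒜}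
    (hy : y ∈ tensorSpan 𝒜 (boundedFamily integralSeminorm moderate))
    (hp : p ∈ tensorSpan 𝒜 (boundedFamily integralSeminorm decaying)) (r : ℕ) :
    ∃ d ∈ tensorSpan 𝒜 (boundedFamily supSeminorm decaying),
      familyCoeff (y + p) r = familyCoeff y r + d := by
  induction r with
  | zero => exact ⟨0, Submodule.zero_mem _, (add_zero _).symm⟩
  | succ r ih =>
    obtain ⟨d, hd, e⟩ := ih
    refine ⟨primitiveFamily.rTensor 𝒜 (y * d + (p * d + p * familyCoeff y r)), ?_, ?_⟩
    · refine rTensor_mem_tensorSpan _ primitiveFamily_mem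
        (Submodule.add_mem _ ?_ (Submodule.add_mem _ ?_ ?_))
      · exact integral_mul_mem (fun _ h _ k => moderate_mul_decaying h k) hy hd
      · exact integral_mul_mem
          (fun _ h _ k => decaying_mul_moderate h (decaying_le_moderate k)) hp hd
      · exact integral_mul_mem (fun _ h _ k => decaying_mul_moderate h k) hp
          (familyCoeff_mem hy r)
    · rw [familyCoeff, familyCoeff, e, ← map_add]
      congr 1
      rw [add_mul, mul_add, mul_add]
      abel

theorem evalFamily_mem (s : J → I01) {G : Submodule ℝ (J → ℝ)} :
    ∀ f ∈ boundedFamily supSeminorm G, evalFamily s f ∈ boundedScalar G :=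
  fun f hf => boundedFamily_map hf _ fun δ => norm_apply_le_supSeminorm (f δ) (s δ)

/-- Two families of equations that differ by a decaying term have the same fundamental solutions,
up to a harmless group term placed at an arbitrary intermediate point. -/
theorem exists_harmless_comparison {y p : Family ⊗[ℂ] 𝒜}
    (hy : y ∈ tensorSpan 𝒜 (boundedFamily integralSeminorm moderate))
    (hp : p ∈ tensorSpan 𝒜 (boundedFamily integralSeminorm decaying)) (s : J → I01) :
    ∃ H ∈ harmlessGroup 𝒜, ∀ (δ : J) (U : 𝒜⟦X⟧),
      U * evalSeries (s δ) (fundamentalSolution (PowerSeries.C (member δ y))) =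
        evalSeries ⟨1, by simp⟩ (fundamentalSolution (PowerSeries.C (member δ y))) →
      evalSeries ⟨1, by simp⟩ (fundamentalSolution (PowerSeries.C (member δ (y + p)))) =
        U * evalJ δ H * evalSeries (s δ) (fundamentalSolution (PowerSeries.C (member δ y))) := by
  let e : J → I01 := fun _ => ⟨1, by simp⟩
  let K : Submodule ℂ ((J → ℂ) ⊗[ℂ] 𝒜) := tensorSpan 𝒜 (boundedScalar moderate)
  let D : Submodule ℂ ((J → ℂ) ⊗[ℂ] 𝒜) := tensorSpan 𝒜 (boundedScalar decaying)
  have hK1 : (1 : (J → ℂ) ⊗[ℂ] 𝒜) ∈ K := one_mem_tensorSpan one_mem_boundedScalar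
  have hKK : ∀ x ∈ K, ∀ z ∈ K, x * z ∈ K := fun _ hx _ hz =>
    mul_mem_tensorSpan (boundedScalar_mul fun _ h _ k => moderate_mul_moderate h k) hx hz
  have hKD : ∀ x ∈ K, ∀ z ∈ D, x * z ∈ D := fun _ hx _ hz =>
    mul_mem_tensorSpan (boundedScalar_mul fun _ h _ k => moderate_mul_decaying h k) hx hz
  have hDK : ∀ x ∈ D, ∀ z ∈ K, x * z ∈ D := fun _ hx _ hz =>
    mul_mem_tensorSpan (boundedScalar_mul fun _ h _ k => decaying_mul_moderate h k) hx hz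
  have hV : ∀ t : J → I01, ∀ r, PowerSeries.coeff r (solutionFamily y t) ∈ K := fun t r => by
    rw [solutionFamily, PowerSeries.coeff_mk]
    exact rTensor_mem_tensorSpan _ (evalFamily_mem t) (familyCoeff_mem hy r)
  have hc : ∀ t : J → I01, PowerSeries.constantCoeff (solutionFamily y t) = 1 := fun t => by
    rw [← PowerSeries.coeff_zero_eq_constantCoeff_apply, solutionFamily, PowerSeries.coeff_mk,
      familyCoeff, Algebra.TensorProduct.one_def, LinearMap.rTensor_tmul,
      AlgHom.toLinearMap_apply, map_one, Algebra.TensorProduct.one_def]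
  let I (t : J → I01) : ((J → ℂ) ⊗[ℂ] 𝒜)⟦X⟧ := PowerSeries.invOfUnit (solutionFamily y t) 1
  have hI : ∀ t : J → I01, ∀ r, PowerSeries.coeff r (I t) ∈ K := fun t r =>
    coeff_invOfUnit_mem hK1 hKK (hV t) r
  have hVI : ∀ t, solutionFamily y t * I t = 1 := fun t =>
    PowerSeries.mul_invOfUnit _ 1 (hc t)
  have hIV : ∀ t, I t * solutionFamily y t = 1 := fun t =>
    PowerSeries.invOfUnit_mul _ 1 (hc t)
  choose d hd e' using exists_familyCoeff_add hy hp
  -- The index is shifted because both solutions have constant term `1`, so their difference is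
  -- divisible by `λ`.
  let N : ((J → ℂ) ⊗[ℂ] 𝒜)⟦X⟧ := PowerSeries.mk fun r =>
    (evalFamily e).toLinearMap.rTensor 𝒜 (d (r + 1))
  have hN : ∀ r, PowerSeries.coeff r N ∈ D := fun r => by
    rw [PowerSeries.coeff_mk]
    exact rTensor_mem_tensorSpan _ (evalFamily_mem e) (hd (r + 1))
  have hW : solutionFamily (y + p) e = solutionFamily y e + PowerSeries.X * N := by
    ext r
    rw [map_add, solutionFamily, PowerSeries.coeff_mk, solutionFamily, PowerSeries.coeff_mk]
    cases r with
    | zero => rw [PowerSeries.coeff_zero_X_mul, familyCoeff, familyCoeff, add_zero]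
    | succ r => rw [PowerSeries.coeff_succ_X_mul, PowerSeries.coeff_mk, e', map_add]
  let F := solutionFamily y s * I e * N * I s
  -- With `V` the model solution and `W` the perturbed one, the witness is `V(s) V(1)⁻¹ W(1)
  -- V(s)⁻¹`. It is found by solving `W(1) = U H V(s)` for `H`, where `U = V(1) V(s)⁻¹`.
  refine ⟨solutionFamily y s * I e * solutionFamily (y + p) e * I s, ⟨F, ?_, ?_⟩, ?_⟩
  · exact isHarmless_of_coeff_mem (coeff_mul_mem hDK
      (coeff_mul_mem hKD (coeff_mul_mem hKK (hV s) (hI e)) hN) (hI s))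
  · have hX := (PowerSeries.commute_X (solutionFamily y s * I e)).eq
    rw [hW, mul_add, ← mul_assoc _ PowerSeries.X, hX, mul_assoc _ (I e), hIV, mul_one, add_mul,
      hVI]
    simp only [F, mul_assoc]
  · intro δ U hU
    have hm : ∀ x z, evalJ δ (x * z) = evalJ (𝒜 := 𝒜) δ x * evalJ δ z := fun x z => map_mul _ x z
    have h1 : evalJ (𝒜 := 𝒜) δ 1 = 1 := map_one _
    have q1 := congrArg (evalJ δ) (hVI e)
    have q2 := congrArg (evalJ δ) (hIV s)
    rw [hm, h1, evalJ_solutionFamily] at q1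
    rw [hm, h1, evalJ_solutionFamily] at q2
    rw [hm, hm, hm, evalJ_solutionFamily, evalJ_solutionFamily]
    simp only [mul_assoc, q2, mul_one]
    rw [← mul_assoc U, hU, ← mul_assoc, q1, one_mul]

/-! ## Evaluation determines an element -/

/-- An element of `C^∞(S) ⊗ 𝒜` is determined by its values. -/
theorem eq_of_forall_evalTensor {E : Type*} [NormedAddCommGroup E] [NormedSpace ℝ E] {S : Set E}
    {z w : smoothFun S ⊗[ℂ] 𝒜}
    (h : ∀ s : S, evalTensor (evalSmooth s) z = evalTensor (evalSmooth s) w) : z = w := by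
  classical
  -- In a basis of `𝒜`, an element of the tensor product becomes a finitely supported family of
  -- scalar functions, and these are determined by their values.
  let 𝒞 := Module.Basis.ofVectorSpace ℂ 𝒜
  have key : ∀ (x : smoothFun S ⊗[ℂ] 𝒜) (i) (s : S),
      (TensorProduct.equivFinsuppOfBasisRight 𝒞 x i).1 s =
        𝒞.repr (evalTensor (evalSmooth s) x) i := by
    intro x i s
    induction x with
    | zero => simp
    | add x y hx hy =>
      rw [map_add, map_add, map_add, Finsupp.add_apply, Finsupp.add_apply, ← hx, ← hy]
      rfl
    | tmul f a =>
      rw [TensorProduct.equivFinsuppOfBasisRight_apply_tmul_apply, evalTensor_tmul, map_smul,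
        Finsupp.smul_apply, smul_eq_mul]
      exact mul_comm (𝒞.repr a i) (f.1 s)
  refine (TensorProduct.equivFinsuppOfBasisRight 𝒞).injective (Finsupp.ext fun i => ?_)
  refine Subtype.ext (funext fun s => ?_)
  rw [key, key, h]

theorem eq_C_of_forall_evalSeries {F : (smoothFun I01 ⊗[ℂ] 𝒜)⟦X⟧} {z : smoothFun I01 ⊗[ℂ] 𝒜}
    (h : ∀ t, evalSeries t F = PowerSeries.C (evalTensor (evalSmooth t) z)) :
    F = PowerSeries.C z := by
  ext r
  refine eq_of_forall_evalTensor fun t => ?_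
  have := congrArg (PowerSeries.coeff r) (h t)
  rw [evalSeries, PowerSeries.coeff_map, PowerSeries.coeff_C] at this
  rw [PowerSeries.coeff_C]
  refine this.trans ?_
  split_ifs <;> simp

/-! ## Connections along paths -/

theorem evalTensor_map {R R' : Type*} [Ring R] [Algebra ℂ R] [Ring R'] [Algebra ℂ R']
    (ψ : R →ₐ[ℂ] R') (φ : R' →ₐ[ℂ] ℂ) (z : R ⊗[ℂ] 𝒜) :
    evalTensor φ (Algebra.TensorProduct.map ψ (AlgHom.id ℂ 𝒜) z) = evalTensor (φ.comp ψ) z := by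
  induction z with
  | zero => simp
  | add x y hx hy => simp only [map_add, hx, hy]
  | tmul f a => rw [Algebra.TensorProduct.map_tmul, evalTensor_tmul, evalTensor_tmul]; rfl

/-- A real function on `[0,1]` and its derivative, as smooth functions. -/
theorem derivSmooth_ofReal_apply {f : ℝ → ℝ} (hf : ContDiffOn ℝ ∞ (fun s => (f s : ℂ)) I01)
    (t : I01) {f' : ℝ} (h : HasDerivWithinAt f f' I01 t) :
    (derivSmooth (smoothRestrict (fun s => (f s : ℂ)) hf)).1 t = f' := by
  have h2 : HasDerivWithinAt (fun s => (f s : ℂ)) (f' : ℂ) I01 t := h.ofReal_comp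
  have h3 : HasDerivWithinAt (extendI01 (smoothRestrict (fun s => (f s : ℂ)) hf).1) (f' : ℂ)
      I01 t := h2.congr (fun y hy => extendI01_apply _ ⟨y, hy⟩) (extendI01_apply _ t)
  exact h3.derivWithin (uniqueDiffOn_Icc zero_lt_one t t.2)

/-- The connection form along a path, computed from the values of the connection. -/
theorem alongPath_eq_C {N : ℕ} {U : Set (Fin N → ℝ)} (Γ : FormalConnection U 𝒜)
    (c : SmoothPath U) (γ : U → Fin N → 𝒜)
    (hΓ : ∀ (x : U) (i : Fin N), PowerSeries.map (evalTensor (𝒜 := 𝒜) (evalSmooth x)).toRingHom (Γ i) =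
      PowerSeries.C (γ x i))
    (v : I01 → Fin N → ℝ)
    (hv : ∀ t i, HasDerivWithinAt (fun s => c.toFun s i) (v t i) I01 t)
    (y : smoothFun I01 ⊗[ℂ] 𝒜)
    (hy : ∀ t : I01, ∑ i, (v t i : ℂ) • γ ⟨c.toFun t, c.mapsTo t.2⟩ i =
      evalTensor (evalSmooth t) y) :
    Γ.alongPath c = PowerSeries.C y := by
  refine eq_C_of_forall_evalSeries fun t => ?_
  rw [← hy, FormalConnection.alongPath, evalSeries, map_sum, map_sum]
  refine Finset.sum_congr rfl fun i _ => ?_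
  have h1 : evalTensor (evalSmooth t) (c.velocity i ⊗ₜ[ℂ] (1 : 𝒜)) = (v t i : ℂ) • (1 : 𝒜) := by
    rw [evalTensor_tmul]
    congr 1
    exact derivSmooth_ofReal_apply _ t (hv t i)
  have h2 : PowerSeries.map (evalTensor (𝒜 := 𝒜) (evalSmooth t)).toRingHom
      (PowerSeries.map (Algebra.TensorProduct.map (compSmooth c.toFun c.smooth c.mapsTo)
        (AlgHom.id ℂ 𝒜)).toRingHom (Γ i)) =
      PowerSeries.C (γ ⟨c.toFun t, c.mapsTo t.2⟩ i) := by
    rw [← hΓ]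
    ext r
    rw [PowerSeries.coeff_map, PowerSeries.coeff_map, PowerSeries.coeff_map]
    exact evalTensor_map _ _ _
  rw [map_mul, h2, PowerSeries.map_C, ← map_mul]
  congr 1
  refine (congrArg _ h1).trans ?_
  rw [mul_smul_comm, mul_one]

/-! ## Reparametrization -/

section Reparametrization

variable {σ : ℝ → ℝ} (hσ : ContDiffOn ℝ ∞ σ I01) (hm : Set.MapsTo σ I01 I01)

theorem derivSmooth_compSmooth (f : smoothFun I01) :
    derivSmooth (compSmooth σ hσ hm f) = compSmooth σ hσ hm (derivSmooth f) *
      derivSmooth (smoothRestrict (fun s => (σ s : ℂ))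
        (Complex.ofRealCLM.contDiff.comp_contDiffOn hσ)) := by
  refine Subtype.ext (funext fun t => ?_)
  have h1 := (hσ.differentiableOn (by simp) t t.2).hasDerivWithinAt
  have h2 := ((contDiffOn_extendI01 f).differentiableOn (by simp) _
    (hm t.2)).hasDerivWithinAt.scomp (t : ℝ) h1 hm
  have h3 : HasDerivWithinAt (extendI01 (compSmooth σ hσ hm f).1)
      (derivWithin σ I01 t • derivWithin (extendI01 f.1) I01 (σ t)) I01 t :=
    h2.congr (fun y hy => (extendI01_apply _ ⟨y, hy⟩).trans
      (extendI01_apply f.1 ⟨σ y, hm hy⟩).symm)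
      ((extendI01_apply _ t).trans (extendI01_apply f.1 ⟨σ t, hm t.2⟩).symm)
  refine (h3.derivWithin (uniqueDiffOn_Icc zero_lt_one t t.2)).trans ?_
  rw [Complex.real_smul, mul_comm]
  exact congrArg _ (derivSmooth_ofReal_apply _ t h1).symm

theorem rTensor_derivSmooth_compSmooth (z : smoothFun I01 ⊗[ℂ] 𝒜) :
    derivSmooth.rTensor 𝒜 (Algebra.TensorProduct.map (compSmooth σ hσ hm) (AlgHom.id ℂ 𝒜) z) =
      Algebra.TensorProduct.map (compSmooth σ hσ hm) (AlgHom.id ℂ 𝒜) (derivSmooth.rTensor 𝒜 z) *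
        derivSmooth (smoothRestrict (fun s => (σ s : ℂ))
          (Complex.ofRealCLM.contDiff.comp_contDiffOn hσ)) ⊗ₜ[ℂ] (1 : 𝒜) := by
  induction z with
  | zero => simp
  | add x y hx hy => simp only [map_add, hx, hy, add_mul]
  | tmul f a =>
    rw [Algebra.TensorProduct.map_tmul, LinearMap.rTensor_tmul, LinearMap.rTensor_tmul,
      Algebra.TensorProduct.map_tmul, Algebra.TensorProduct.tmul_mul_tmul, mul_one,
      derivSmooth_compSmooth]

theorem rTensor_derivSmooth_mul (z : smoothFun I01 ⊗[ℂ] 𝒜) (a : 𝒜) :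
    derivSmooth.rTensor 𝒜 (z * (1 : smoothFun I01) ⊗ₜ[ℂ] a) =
      derivSmooth.rTensor 𝒜 z * (1 : smoothFun I01) ⊗ₜ[ℂ] a := by
  induction z with
  | zero => simp
  | add x y hx hy => simp only [map_add, hx, hy, add_mul]
  | tmul f b => simp only [Algebra.TensorProduct.tmul_mul_tmul, LinearMap.rTensor_tmul, mul_one]

theorem tmul_one_mul_comm {R : Type*} [CommRing R] [Algebra ℂ R] (f : R) (z : R ⊗[ℂ] 𝒜) :
    f ⊗ₜ[ℂ] (1 : 𝒜) * z = z * f ⊗ₜ[ℂ] (1 : 𝒜) := by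
  induction z with
  | zero => simp
  | add x y hx hy => simp only [mul_add, hx, hy, add_mul]
  | tmul g b => simp only [Algebra.TensorProduct.tmul_mul_tmul, mul_one, one_mul, mul_comm f g]

theorem constantCoeff_evalSeries_fundamentalSolution (Y : (smoothFun I01 ⊗[ℂ] 𝒜)⟦X⟧) (t : I01) :
    PowerSeries.constantCoeff (evalSeries t (fundamentalSolution Y)) = 1 := by
  rw [← PowerSeries.coeff_zero_eq_constantCoeff_apply, evalSeries, PowerSeries.coeff_map,
    fundamentalSolution, PowerSeries.coeff_mk, fundamentalCoeff, map_one]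

theorem evalSeries_mul (t : I01) (F G : (smoothFun I01 ⊗[ℂ] 𝒜)⟦X⟧) :
    evalSeries t (F * G) = evalSeries t F * evalSeries t G :=
  map_mul _ F G

/-- The fundamental solution for a reparametrized equation. -/
theorem fundamentalSolution_reparametrization (Y : (smoothFun I01 ⊗[ℂ] 𝒜)⟦X⟧) (t : I01) :
    evalSeries t (fundamentalSolution
      (PowerSeries.map (Algebra.TensorProduct.map (compSmooth σ hσ hm)
          (AlgHom.id ℂ 𝒜)).toRingHom Y *
        PowerSeries.C (derivSmooth (smoothRestrict (fun s => (σ s : ℂ))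
          (Complex.ofRealCLM.contDiff.comp_contDiffOn hσ)) ⊗ₜ[ℂ] (1 : 𝒜)))) *
      evalSeries ⟨σ 0, hm ⟨le_rfl, zero_le_one⟩⟩ (fundamentalSolution Y) =
    evalSeries ⟨σ t, hm t.2⟩ (fundamentalSolution Y) := by
  let W := fundamentalSolution Y
  let S := (Algebra.TensorProduct.map (compSmooth σ hσ hm) (AlgHom.id ℂ 𝒜)).toRingHom
  let d : smoothFun I01 ⊗[ℂ] 𝒜 := derivSmooth (smoothRestrict (fun s => (σ s : ℂ))
    (Complex.ofRealCLM.contDiff.comp_contDiffOn hσ)) ⊗ₜ[ℂ] (1 : 𝒜)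
  let ι : 𝒜 →+* smoothFun I01 ⊗[ℂ] 𝒜 :=
    (Algebra.TensorProduct.includeRight : 𝒜 →ₐ[ℂ] smoothFun I01 ⊗[ℂ] 𝒜).toRingHom
  let g := evalSeries ⟨σ 0, hm ⟨le_rfl, zero_le_one⟩⟩ W
  have hg := constantCoeff_evalSeries_fundamentalSolution Y
    ⟨σ 0, hm ⟨le_rfl, zero_le_one⟩⟩
  let g' := PowerSeries.invOfUnit g 1
  have hgg : g * g' = 1 := PowerSeries.mul_invOfUnit _ 1 hg
  have hgg' : g' * g = 1 := PowerSeries.invOfUnit_mul _ 1 hg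
  -- The candidate is `t ↦ W(σ(t)) W(σ(0))⁻¹`. Uniqueness of the normalized solution identifies it,
  -- without monotonicity of `σ` or conditions on its end values.
  let w := PowerSeries.map S W * PowerSeries.map ι g'
  have hev : ∀ u : I01, evalSeries u w = evalSeries ⟨σ u, hm u.2⟩ W * g' := fun u => by
    rw [evalSeries_mul]
    congr 1
    · ext r
      rw [evalSeries, PowerSeries.coeff_map, PowerSeries.coeff_map, evalSeries,
        PowerSeries.coeff_map]
      exact evalTensor_map _ _ _
    · ext r
      rw [evalSeries, PowerSeries.coeff_map, PowerSeries.coeff_map]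
      refine (evalTensor_tmul _ _ _).trans ?_
      rw [map_one, one_smul]
  have h1 : derivSeries (PowerSeries.map S W) =
      PowerSeries.map S (derivSeries W) * PowerSeries.C d := by
    ext r
    rw [derivSeries, PowerSeries.coeff_mk, PowerSeries.coeff_mul_C, PowerSeries.coeff_map,
      PowerSeries.coeff_map, derivSeries, PowerSeries.coeff_mk]
    exact rTensor_derivSmooth_compSmooth hσ hm _
  have h2 : derivSeries w = derivSeries (PowerSeries.map S W) * PowerSeries.map ι g' := by
    ext r
    rw [derivSeries, PowerSeries.coeff_mk, PowerSeries.coeff_mul, PowerSeries.coeff_mul, map_sum]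
    refine Finset.sum_congr rfl fun p _ => ?_
    rw [PowerSeries.coeff_map ι, derivSeries, PowerSeries.coeff_mk]
    exact rTensor_derivSmooth_mul _ _
  -- The factor `σ' ⊗ 1` is central, so it can be moved from the right of `W ∘ σ`, where the chain
  -- rule produces it, into the form of the equation.
  have hd : ∀ F : (smoothFun I01 ⊗[ℂ] 𝒜)⟦X⟧, F * PowerSeries.C d = PowerSeries.C d * F := by
    intro F
    ext r
    rw [PowerSeries.coeff_mul_C, PowerSeries.coeff_C_mul]
    exact (tmul_one_mul_comm _ _).symm
  have hw : derivSeries w =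
      PowerSeries.X * ((PowerSeries.map S Y * PowerSeries.C d) * w) := by
    rw [h2, h1, show derivSeries W = PowerSeries.X * (Y * W) from fundamentalSolution_deriv Y,
      map_mul, map_mul, PowerSeries.map_X, mul_assoc _ _ (PowerSeries.C d),
      mul_assoc _ _ (PowerSeries.C d), hd (PowerSeries.map S W)]
    simp only [w, mul_assoc]
  have h0 : evalSeries ⟨0, by simp⟩ w = 1 := (hev _).trans hgg
  change evalSeries t (fundamentalSolution (PowerSeries.map S Y * PowerSeries.C d)) * g = _
  rw [← eq_fundamentalSolution _ w hw h0, hev, mul_assoc, hgg', mul_one]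

end Reparametrization

/-- Parallel transport along a path whose connection form is a reparametrization of `y`. -/
theorem parallelTransport_mul {σ : ℝ → ℝ} (hσ : ContDiffOn ℝ ∞ σ I01)
    (hm : Set.MapsTo σ I01 I01) {N : ℕ} {U : Set (Fin N → ℝ)} (Γ : FormalConnection U 𝒜)
    (c : SmoothPath U) (γ : U → Fin N → 𝒜)
    (hΓ : ∀ (x : U) (i : Fin N), PowerSeries.map (evalTensor (𝒜 := 𝒜) (evalSmooth x)).toRingHom (Γ i) =
      PowerSeries.C (γ x i))
    (v : I01 → Fin N → ℝ)
    (hv : ∀ t i, HasDerivWithinAt (fun s => c.toFun s i) (v t i) I01 t)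
    (y : smoothFun I01 ⊗[ℂ] 𝒜) (σ' : I01 → ℝ)
    (hσ' : ∀ t : I01, HasDerivWithinAt σ (σ' t) I01 t)
    (hy : ∀ t : I01, ∑ i, (v t i : ℂ) • γ ⟨c.toFun t, c.mapsTo t.2⟩ i =
      (σ' t : ℂ) • evalTensor (evalSmooth ⟨σ t, hm t.2⟩) y) :
    parallelTransport Γ c *
      evalSeries ⟨σ 0, hm ⟨le_rfl, zero_le_one⟩⟩ (fundamentalSolution (PowerSeries.C y)) =
    evalSeries ⟨σ 1, hm ⟨zero_le_one, le_rfl⟩⟩ (fundamentalSolution (PowerSeries.C y)) := by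
  rw [parallelTransport, ← fundamentalSolution_reparametrization hσ hm _ ⟨1, by simp⟩]
  congr 3
  rw [PowerSeries.map_C, ← map_mul]
  refine alongPath_eq_C Γ c γ hΓ v hv _ fun t => ?_
  rw [hy, map_mul, evalTensor_tmul, mul_smul_comm, mul_one]
  have h1 : evalSmooth t (derivSmooth (smoothRestrict (fun s => (σ s : ℂ))
      (Complex.ofRealCLM.contDiff.comp_contDiffOn hσ))) = (σ' t : ℂ) :=
    derivSmooth_ofReal_apply _ t (hσ' t)
  rw [h1]
  congr 1
  exact (evalTensor_map (compSmooth σ hσ hm) (evalSmooth t) y).symm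

/-! ## Logarithmic derivatives of affine functions -/

/-- The logarithmic derivative of the affine function on `[0,1]` with the positive values `p` at `0`
and `q` at `1`. -/
def logDer (p q : Set.Ioi (0 : ℝ)) : smoothFun I01 :=
  smoothRestrict (fun s : ℝ => ((((q : ℝ) - p) / ((1 - s) * p + s * q) : ℝ) : ℂ))
    (Complex.ofRealCLM.contDiff.comp_contDiffOn (ContDiffOn.div (by fun_prop) (by fun_prop)
      fun s hs => (convex_Ioi (0 : ℝ) p.2 q.2 (sub_nonneg.2 hs.2) hs.1
        (sub_add_cancel 1 s) : (0 : ℝ) < (1 - s) * p + s * q).ne'))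

theorem affine_pos (p q : Set.Ioi (0 : ℝ)) (t : I01) :
    0 < (1 - (t : ℝ)) * p + t * q :=
  convex_Ioi (0 : ℝ) p.2 q.2 (sub_nonneg.2 t.2.2) t.2.1 (sub_add_cancel 1 _)

theorem evalSmooth_logDer (p q : Set.Ioi (0 : ℝ)) (t : I01) :
    evalSmooth t (logDer p q) = (((q : ℝ) - p) / ((1 - (t : ℝ)) * p + t * q) : ℝ) := rfl

/-! ### The model path from a to 1 - b and the half-paths -/

/-- A point of `]0, 1/4]` as a positive number. -/
def posJ (a : J) : Set.Ioi (0 : ℝ) := ⟨a, a.2.1⟩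

/-- The positive number `1 - a`. -/
def oneSubJ (a : J) : Set.Ioi (0 : ℝ) := ⟨1 - a, by
  have := a.2.2
  rw [Set.mem_Ioi]
  linarith⟩

/-- The form of `Γ(B, A)` along the affine path from `a` to `1 - b`. -/
def modelForm (a b : J) (A B : 𝒜) : smoothFun I01 ⊗[ℂ] 𝒜 :=
  logDer (posJ a) (oneSubJ b) ⊗ₜ[ℂ] A + logDer (oneSubJ a) (posJ b) ⊗ₜ[ℂ] B

/-- The parameter of the point `1/2` on the affine path from `a` to `1 - b`. -/
def halfParam (a b : J) : I01 := ⟨(1 / 2 - a) / (1 - a - b), by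
  have h1 := a.2.2
  have h2 := b.2.2
  constructor
  · exact div_nonneg (by linarith) (by linarith)
  · rw [div_le_one (by linarith)]
    linarith⟩

theorem twoPointConnection_apply (B A : 𝒜) (x : unitOpen) (i : Fin 1) :
    PowerSeries.map (evalTensor (𝒜 := 𝒜) (evalSmooth x)).toRingHom (twoPointConnection B A i) =
      PowerSeries.C ((((x.1 0)⁻¹ : ℝ) : ℂ) • A + (((x.1 0 - 1)⁻¹ : ℝ) : ℂ) • B) := by
  rw [twoPointConnection, PowerSeries.map_C]
  congr 1

/-- The half-path as a real function. -/
def halfFun (ε : J) (s : ℝ) : ℝ := 1 - 1 / 2 * Real.exp (Real.log (2 * ε) * s)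

/-- The derivative of the half-path. -/
def halfFunDeriv (ε : J) (s : ℝ) : ℝ :=
  -(1 / 2 * (Real.exp (Real.log (2 * ε) * s) * Real.log (2 * ε)))

theorem contDiff_halfFun (ε : J) : ContDiff ℝ ∞ (halfFun ε) := by
  unfold halfFun
  fun_prop

theorem hasDerivAt_halfFun (ε : J) (s : ℝ) : HasDerivAt (halfFun ε) (halfFunDeriv ε s) s := by
  have h := ((((hasDerivAt_id s).const_mul (Real.log (2 * ε))).exp).const_mul (1 / 2)).const_sub 1
  simp only [id, mul_one] at h
  exact h

theorem halfFun_zero (ε : J) : halfFun ε 0 = 1 / 2 := by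
  norm_num [halfFun]

theorem halfFun_one (ε : J) : halfFun ε 1 = 1 - ε := by
  rw [halfFun, mul_one, Real.exp_log (by linarith [ε.2.1])]
  ring

theorem halfFun_mem (ε : J) {s : ℝ} (hs : s ∈ I01) : halfFun ε s ∈ Set.Icc (1 / 2) (1 - (ε : ℝ)) := by
  have h1 : Real.log (2 * ε) ≤ 0 :=
    Real.log_nonpos (by linarith [ε.2.1]) (by linarith [ε.2.2])
  have h2 : Real.exp (Real.log (2 * ε) * s) ≤ 1 :=
    Real.exp_le_one_iff.2 (mul_nonpos_of_nonpos_of_nonneg h1 hs.1)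
  have h3 : Real.exp (Real.log (2 * ε)) ≤ Real.exp (Real.log (2 * ε) * s) :=
    Real.exp_le_exp.2 (by nlinarith [hs.2])
  rw [Real.exp_log (by linarith [ε.2.1])] at h3
  constructor <;> unfold halfFun <;> linarith

theorem evalTensor_modelForm (a b : J) (A B : 𝒜) (t : I01) :
    evalTensor (evalSmooth t) (modelForm a b A B) =
      (((1 - a - b) / (a + t * (1 - a - b)) : ℝ) : ℂ) • A -
        (((1 - a - b) / (1 - (a + t * (1 - a - b))) : ℝ) : ℂ) • B := by
  rw [modelForm, map_add, evalTensor_tmul, evalTensor_tmul, evalSmooth_logDer, evalSmooth_logDer,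
    sub_eq_add_neg (_ • A), ← neg_smul, ← Complex.ofReal_neg]
  simp only [posJ, oneSubJ]
  congr 4
  · ring
  · ring
  · rw [← neg_div]
    congr 1 <;> ring

/-- The half-path stays in `[1/2, 1 - b]`, so it is the affine path from `a` to `1 - b` run through
`σ(t) = (h(t) - a)/(1 - a - b)`, where `h` is the half-path; `σ` leads from the parameter of `1/2`
to `1`. -/
theorem modelForm_transport_right (a b : J) (A B : 𝒜) :
    parallelTransport (twoPointConnection B A) (halfPath b) *
      evalSeries (halfParam a b) (fundamentalSolution (PowerSeries.C (modelForm a b A B))) =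
    evalSeries ⟨1, by simp⟩ (fundamentalSolution (PowerSeries.C (modelForm a b A B))) := by
  have ha := a.2.2
  have hb := b.2.2
  have hb0 := b.2.1
  have hpos : 0 < 1 - (a : ℝ) - b := by linarith
  let σ : ℝ → ℝ := fun t => (halfFun b t - a) / (1 - a - b)
  have hσ : ContDiffOn ℝ ∞ σ I01 := (((contDiff_halfFun b).sub contDiff_const).div_const _).contDiffOn
  have hm : Set.MapsTo σ I01 I01 := fun t ht => by
    have h := halfFun_mem b ht
    refine ⟨div_nonneg (by linarith [h.1]) hpos.le, ?_⟩
    rw [div_le_one hpos]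
    linarith [h.2]
  have key := parallelTransport_mul hσ hm (twoPointConnection B A) (halfPath b) _
    (twoPointConnection_apply B A) (fun t _ => halfFunDeriv b t)
    (fun t _ => (hasDerivAt_halfFun b t).hasDerivWithinAt) (modelForm a b A B)
    (fun t => halfFunDeriv b t / (1 - (a : ℝ) - b))
    (fun t => (((hasDerivAt_halfFun b t).sub_const _).div_const _).hasDerivWithinAt) (by
      intro t
      have h := halfFun_mem b t.2
      have e1 : (a : ℝ) + σ t * (1 - a - b) = halfFun b t := by
        simp only [σ]
        field_simp
        ring
      have e2 : (halfPath b).toFun t 0 = halfFun b t := rfl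
      rw [evalTensor_modelForm, Fin.sum_univ_one]
      simp only [e1, e2]
      rw [smul_add, smul_sub, smul_smul, smul_smul, smul_smul, smul_smul, sub_eq_add_neg (_ • A),
        ← neg_smul]
      simp only [← Complex.ofReal_mul, ← Complex.ofReal_neg]
      have n1 : halfFun b t ≠ 0 := by linarith [h.1]
      have n2 : 1 - halfFun b t ≠ 0 := by linarith [h.2]
      have n3 : halfFun b t - 1 ≠ 0 := by linarith [h.2]
      congr 3
      · field_simp
      · field_simp
        ring)
  have e0 : σ 0 = (1 / 2 - a) / (1 - a - b) := by simp only [σ, halfFun_zero]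
  have e1 : σ 1 = 1 := by
    simp only [σ, halfFun_one]
    rw [div_eq_one_iff_eq hpos.ne']
    ring
  simp only [e0, e1] at key
  exact key

/-- The reflected half-path `1 - h` leads from `1/2` back to `a`, and reflection exchanges the
residues. Its parameter on the affine path ends at `0`, where the solution is `1`. -/
theorem modelForm_transport_left (a b : J) (A B : 𝒜) :
    parallelTransport (twoPointConnection A B) (halfPath a) *
      evalSeries (halfParam a b) (fundamentalSolution (PowerSeries.C (modelForm a b A B))) = 1 := by
  have ha := a.2.2
  have hb := b.2.2
  have ha0 := a.2.1
  have hpos : 0 < 1 - (a : ℝ) - b := by linarith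
  let σ : ℝ → ℝ := fun t => (1 - halfFun a t - a) / (1 - a - b)
  have hσ : ContDiffOn ℝ ∞ σ I01 :=
    (((contDiff_const.sub (contDiff_halfFun a)).sub contDiff_const).div_const _).contDiffOn
  have hm : Set.MapsTo σ I01 I01 := fun t ht => by
    have h := halfFun_mem a ht
    refine ⟨div_nonneg (by linarith [h.2]) hpos.le, ?_⟩
    rw [div_le_one hpos]
    linarith [h.1]
  have key := parallelTransport_mul hσ hm (twoPointConnection A B) (halfPath a) _
    (twoPointConnection_apply A B) (fun t _ => halfFunDeriv a t)
    (fun t _ => (hasDerivAt_halfFun a t).hasDerivWithinAt) (modelForm a b A B)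
    (fun t => -halfFunDeriv a t / (1 - (a : ℝ) - b))
    (fun t => ((((hasDerivAt_halfFun a t).const_sub _).sub_const _).div_const _).hasDerivWithinAt)
    (by
      intro t
      have h := halfFun_mem a t.2
      have e1 : (a : ℝ) + σ t * (1 - a - b) = 1 - halfFun a t := by
        simp only [σ]
        field_simp
        ring
      have e2 : (halfPath a).toFun t 0 = halfFun a t := rfl
      rw [evalTensor_modelForm, Fin.sum_univ_one]
      simp only [e1, e2, sub_sub_cancel]
      rw [smul_add, smul_sub, smul_smul, smul_smul, smul_smul, smul_smul, sub_eq_add_neg (_ • A),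
        ← neg_smul, add_comm]
      simp only [← Complex.ofReal_mul, ← Complex.ofReal_neg]
      have n1 : halfFun a t ≠ 0 := by linarith [h.1]
      have n2 : 1 - halfFun a t ≠ 0 := by linarith [h.2]
      have n3 : halfFun a t - 1 ≠ 0 := by linarith [h.2]
      congr 3
      · field_simp
        ring
      · field_simp)
  have e0 : σ 0 = (1 / 2 - a) / (1 - a - b) := by
    simp only [σ, halfFun_zero]
    norm_num
  have e1 : σ 1 = 0 := by
    simp only [σ, halfFun_one]
    simp
  have key2 := key.trans ((by simp only [e1]) : _ = evalSeries ⟨0, ⟨le_rfl, zero_le_one⟩⟩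
    (fundamentalSolution (PowerSeries.C (modelForm a b A B))))
  rw [evalSeries_fundamentalSolution_zero] at key2
  simp only [e0] at key2
  exact key2

/-! ## Formal exponentials -/

/-- Every term in degree `n` is a scalar multiple of `B ^ n`, and by the binomial theorem the
scalars add up to `(c - c)ⁿ / n!`. -/
theorem formalExp_mul_formalExp_neg (c : ℝ) (B : 𝒜) :
    formalExp c B * formalExp (-c) B = 1 := by
  ext n
  rw [PowerSeries.coeff_mul, PowerSeries.coeff_one]
  have h : ∀ p ∈ Finset.HasAntidiagonal.antidiagonal n,
      PowerSeries.coeff p.1 (formalExp c B) * PowerSeries.coeff p.2 (formalExp (-c) B) =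
        (((c ^ p.1 / p.1.factorial * ((-c) ^ p.2 / p.2.factorial) : ℝ)) : ℂ) • B ^ n := by
    intro p hp
    rw [formalExp, PowerSeries.coeff_mk, formalExp, PowerSeries.coeff_mk, smul_mul_smul_comm,
      ← pow_add, Finset.HasAntidiagonal.mem_antidiagonal.1 hp, Complex.ofReal_mul]
  rw [Finset.sum_congr rfl h, ← Finset.sum_smul, ← Complex.ofReal_sum]
  have h2 : ∑ p ∈ Finset.HasAntidiagonal.antidiagonal n, c ^ p.1 / p.1.factorial * ((-c) ^ p.2 / p.2.factorial) =
      (c + -c) ^ n / n.factorial := by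
    rw [(Commute.all c (-c)).add_pow', Finset.sum_div]
    refine Finset.sum_congr rfl fun p hp => ?_
    have h3 := Nat.add_choose_mul_factorial_mul_factorial p.1 p.2
    rw [Finset.HasAntidiagonal.mem_antidiagonal.1 hp, Nat.choose_symm_of_eq_add
      ((add_comm p.2 p.1).trans (Finset.HasAntidiagonal.mem_antidiagonal.1 hp)).symm] at h3
    have h4 : ((n.choose p.1 : ℕ) : ℝ) * p.1.factorial * p.2.factorial = n.factorial := by
      exact_mod_cast h3
    have f1 : (p.1.factorial : ℝ) ≠ 0 := by positivity
    have f2 : (p.2.factorial : ℝ) ≠ 0 := by positivity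
    have f3 : (n.factorial : ℝ) ≠ 0 := by positivity
    rw [nsmul_eq_mul]
    field_simp
    rw [← h4]
    ring
  rw [h2, add_neg_cancel]
  cases n with
  | zero => simp
  | succ n => simp

theorem parallelTransport_halfPath (ε : J) (B A : 𝒜) :
    parallelTransport (twoPointConnection B A) (halfPath ε) =
      formalExp (Real.log ε) B * (psi ε B A : 𝒜⟦X⟧) := by
  change _ = _ * (formalExp (-Real.log ε) B * _)
  rw [← mul_assoc, formalExp_mul_formalExp_neg, one_mul]

theorem evalSeries_halfParam (a b : J) (A B : 𝒜) :
    evalSeries (halfParam a b) (fundamentalSolution (PowerSeries.C (modelForm a b A B))) =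
      ((psi a A B)⁻¹ : (𝒜⟦X⟧)ˣ) * formalExp (-Real.log a) A := by
  have h := modelForm_transport_left a b A B
  rw [parallelTransport_halfPath] at h
  have h2 : ((psi a A B)⁻¹ : (𝒜⟦X⟧)ˣ) * formalExp (-Real.log a) A *
      (formalExp (Real.log a) A * (psi a A B : 𝒜⟦X⟧)) = 1 := by
    have h3 := formalExp_mul_formalExp_neg (-Real.log a) A
    rw [neg_neg] at h3
    rw [mul_assoc, ← mul_assoc (formalExp (-Real.log a) A), h3, one_mul, Units.inv_mul]
  exact (left_inv_eq_right_inv h2 h).symm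

/-! ## Estimates for logarithmic derivatives -/

/-- The inverse of the affine function on `[0,1]` with the positive values `p` at `0` and `q` at
`1`. -/
def invAffine (p q : Set.Ioi (0 : ℝ)) : smoothFun I01 :=
  smoothRestrict (fun s : ℝ => ((((1 - s) * p + s * q)⁻¹ : ℝ) : ℂ))
    (Complex.ofRealCLM.contDiff.comp_contDiffOn (ContDiffOn.inv (by fun_prop)
      fun s hs => (affine_pos p q ⟨s, hs⟩).ne'))

theorem norm_invAffine_apply (p q : Set.Ioi (0 : ℝ)) (t : I01) :
    ‖(invAffine p q).1 t‖ = ((1 - (t : ℝ)) * p + t * q)⁻¹ :=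
  (Complex.norm_real _).trans (abs_of_pos (inv_pos.2 (affine_pos p q t)))

theorem integralSeminorm_le_mul {f g : smoothFun I01} {c : ℝ}
    (h : ∀ t : I01, ‖f.1 t‖ ≤ c * ‖g.1 t‖) : integralSeminorm f ≤ c * integralSeminorm g := by
  rw [integralSeminorm_apply, integralSeminorm_apply, ← intervalIntegral.integral_const_mul]
  exact intervalIntegral.integral_mono_on zero_le_one
    ((continuous_extendI01 f).norm.intervalIntegrable _ _)
    ((continuous_const.mul (continuous_extendI01 g).norm).intervalIntegrable _ _)
    fun t _ => h (Set.projIcc 0 1 zero_le_one t)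

/-- The logarithm of the affine function is a primitive. This is the source of the merely
logarithmic growth in `δ`. -/
theorem sub_mul_integralSeminorm_invAffine (p q : Set.Ioi (0 : ℝ)) :
    ((q : ℝ) - p) * integralSeminorm (invAffine p q) = Real.log q - Real.log p := by
  rw [integralSeminorm_apply, ← intervalIntegral.integral_const_mul]
  have h : ∀ s ∈ Set.uIcc (0 : ℝ) 1, HasDerivAt (fun s : ℝ => Real.log ((1 - s) * p + s * q))
      (((q : ℝ) - p) * ‖extendI01 (invAffine p q).1 s‖) s := by
    intro s hs
    rw [Set.uIcc_of_le zero_le_one] at hs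
    have hpos := affine_pos p q ⟨s, hs⟩
    have h1 : HasDerivAt (fun s : ℝ => (1 - s) * (p : ℝ) + s * q) (-1 * (p : ℝ) + 1 * q) s :=
      (((hasDerivAt_id s).const_sub 1).mul_const _).add ((hasDerivAt_id s).mul_const _)
    have h2 := h1.log hpos.ne'
    have h3 : ‖extendI01 (invAffine p q).1 s‖ = ((1 - s) * p + s * q)⁻¹ := by
      rw [show extendI01 (invAffine p q).1 s = _ from extendI01_apply _ ⟨s, hs⟩,
        norm_invAffine_apply]
    rw [h3]
    convert h2 using 1
    rw [div_eq_mul_inv]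
    ring
  rw [intervalIntegral.integral_eq_sub_of_hasDerivAt h
    ((continuous_const.mul (continuous_extendI01 _).norm).intervalIntegrable _ _)]
  simp

theorem integralSeminorm_invAffine_self (p : Set.Ioi (0 : ℝ)) :
    integralSeminorm (invAffine p p) ≤ (p : ℝ)⁻¹ := by
  have h : ∀ t : I01, ‖(invAffine p p).1 t‖ = (p : ℝ)⁻¹ := fun t => by
    rw [norm_invAffine_apply]
    congr 1
    ring
  have h2 : integralSeminorm (invAffine p p) = ∫ t in (0 : ℝ)..1, (p : ℝ)⁻¹ :=
    intervalIntegral.integral_congr fun t _ => h (Set.projIcc 0 1 zero_le_one t)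
  rw [h2]
  simp

theorem log_sub_log_abs_le {δ x y : ℝ} (hδ : 0 < δ) (hx : δ ^ 2 ≤ x) (hx1 : x ≤ 1)
    (hy : δ ^ 2 ≤ y) (hy1 : y ≤ 1) : |Real.log x - Real.log y| ≤ -(2 * Real.log δ) := by
  have h0 : 0 < δ ^ 2 := by positivity
  have e : Real.log (δ ^ 2) = 2 * Real.log δ := by simp [Real.log_pow]
  have h1 := Real.log_le_log h0 hx
  have h2 := Real.log_le_log h0 hy
  have h3 := Real.log_nonpos (h0.le.trans hx) hx1
  have h4 := Real.log_nonpos (h0.le.trans hy) hy1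
  rw [abs_le]
  constructor <;> linarith

/-- The logarithms of the end values lie in `[2 ln δ, 0]`; dividing their difference by a slope of
size at least `1/2` gives the constant `4`. -/
theorem integralSeminorm_invAffine_le {δ : ℝ} (hδ : 0 < δ) {p q : Set.Ioi (0 : ℝ)}
    (hp : δ ^ 2 ≤ (p : ℝ)) (hp1 : (p : ℝ) ≤ 1) (hq : δ ^ 2 ≤ (q : ℝ)) (hq1 : (q : ℝ) ≤ 1)
    (h : 1 / 2 ≤ |(q : ℝ) - p|) : integralSeminorm (invAffine p q) ≤ -(4 * Real.log δ) := by
  have h1 := log_sub_log_abs_le hδ hq hq1 hp hp1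
  have h2 : 0 ≤ integralSeminorm (invAffine p q) := apply_nonneg _ _
  rw [← sub_mul_integralSeminorm_invAffine, abs_mul, abs_of_nonneg h2] at h1
  nlinarith [mul_le_mul_of_nonneg_right h h2]

/-- The difference of two logarithmic derivatives is governed by the Wronskian. -/
theorem logDer_sub_apply (p q p' q' : Set.Ioi (0 : ℝ)) (t : I01) :
    ‖(logDer p q - logDer p' q').1 t‖ = |(q : ℝ) * p' - p * q'| *
      ((1 - (t : ℝ)) * p + t * q)⁻¹ * ‖(invAffine p' q').1 t‖ := by
  have h1 := affine_pos p q t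
  have h2 := affine_pos p' q' t
  have e : (logDer p q - logDer p' q').1 t =
      (((q * p' - p * q') * ((1 - (t : ℝ)) * p + t * q)⁻¹ * ((1 - (t : ℝ)) * p' + t * q')⁻¹ : ℝ) :
        ℂ) := by
    change (((((q : ℝ) - p) / ((1 - t) * p + t * q) : ℝ) : ℂ)) -
      (((((q' : ℝ) - p') / ((1 - t) * p' + t * q') : ℝ) : ℂ)) = _
    rw [← Complex.ofReal_sub]
    rw [div_sub_div _ _ h1.ne' h2.ne', mul_assoc, ← mul_inv, ← div_eq_mul_inv]
    congr 2
    ring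
  rw [e, Complex.norm_real, norm_invAffine_apply, norm_mul, norm_mul, Real.norm_eq_abs,
    Real.norm_eq_abs, Real.norm_eq_abs, abs_of_pos (inv_pos.2 h1), abs_of_pos (inv_pos.2 h2)]

/-- The Wronskian is constant, so bounding it by `ε` times the affine function on all of `[0,1]`
reduces to the two end points, by convexity. Proportional functions have Wronskian `0`, and `ε`
measures the relative error. -/
theorem integralSeminorm_logDer_sub_le {p q p' q' : Set.Ioi (0 : ℝ)} {ε : ℝ}
    (h1 : |(q : ℝ) * p' - p * q'| ≤ ε * p) (h2 : |(q : ℝ) * p' - p * q'| ≤ ε * q) :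
    integralSeminorm (logDer p q - logDer p' q') ≤ ε * integralSeminorm (invAffine p' q') := by
  refine integralSeminorm_le_mul fun t => ?_
  rw [logDer_sub_apply]
  refine mul_le_mul_of_nonneg_right ?_ (norm_nonneg _)
  rw [← div_eq_mul_inv, div_le_iff₀ (affine_pos p q t)]
  have k1 := mul_le_mul_of_nonneg_left h1 (sub_nonneg.2 t.2.2)
  have k2 := mul_le_mul_of_nonneg_left h2 t.2.1
  linarith

theorem integralSeminorm_logDer_le {p q : Set.Ioi (0 : ℝ)} (hp1 : (p : ℝ) ≤ 1)
    (hq1 : (q : ℝ) ≤ 1) : integralSeminorm (logDer p q) ≤ integralSeminorm (invAffine p q) := by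
  rw [← one_mul (integralSeminorm (invAffine p q))]
  refine integralSeminorm_le_mul fun t => ?_
  rw [norm_invAffine_apply]
  refine (Complex.norm_real _).le.trans ?_
  have hp0 : (0 : ℝ) < p := p.2
  have hq0 : (0 : ℝ) < q := q.2
  rw [Real.norm_eq_abs, abs_div, abs_of_pos (affine_pos p q t), div_eq_mul_inv]
  refine mul_le_mul_of_nonneg_right ?_ (inv_pos.2 (affine_pos p q t)).le
  rw [abs_le]
  constructor <;> linarith

/-! ## The connection along an affine path in the triangle -/

/-- The five positive affine functions `x₂, x₃, x₃ - x₂, 1 - x₂, 1 - x₃` on the triangle. -/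
def wall (x : triangle) : Fin 5 → Set.Ioi (0 : ℝ) :=
  ![⟨x.1 0, x.2.1⟩, ⟨x.1 1, x.2.1.trans x.2.2.1⟩, ⟨x.1 1 - x.1 0, sub_pos.2 x.2.2.1⟩,
    ⟨1 - x.1 0, sub_pos.2 (x.2.2.1.trans x.2.2.2)⟩, ⟨1 - x.1 1, sub_pos.2 x.2.2.2⟩]

/-- The residues of the connection along the zero sets of the functions `wall`. -/
def residue (A : Fin 4 → Fin 4 → 𝒜) : Fin 5 → 𝒜 := ![A 0 1, A 0 2, A 1 2, A 1 3, A 2 3]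

theorem pentagonConnection_alongPath (A : Fin 4 → Fin 4 → 𝒜) (ξ η : triangle) :
    (pentagonConnection A).alongPath (affinePath convex_triangle ξ η) =
      PowerSeries.C (∑ k, logDer (wall ξ k) (wall η k) ⊗ₜ[ℂ] residue A k) := by
  refine alongPath_eq_C _ _ (fun x => ![(((x.1 0)⁻¹ : ℝ) : ℂ) • A 0 1 +
      (((x.1 0 - x.1 1)⁻¹ : ℝ) : ℂ) • A 1 2 + (((x.1 0 - 1)⁻¹ : ℝ) : ℂ) • A 1 3,
    (((x.1 1)⁻¹ : ℝ) : ℂ) • A 0 2 - (((x.1 0 - x.1 1)⁻¹ : ℝ) : ℂ) • A 1 2 +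
      (((x.1 1 - 1)⁻¹ : ℝ) : ℂ) • A 2 3]) (fun x i => ?_)
    (fun _ i => η.1 i - ξ.1 i) (fun t i => ?_) _ fun t => ?_
  · fin_cases i
    · exact pentagonConnection_zero A x
    · exact pentagonConnection_one A x
  · have h := (((hasDerivAt_id (t : ℝ)).const_sub 1).mul_const (ξ.1 i)).add
      ((hasDerivAt_id (t : ℝ)).mul_const (η.1 i))
    have e : -1 * ξ.1 i + 1 * η.1 i = η.1 i - ξ.1 i := by ring
    rw [e] at h
    exact h.hasDerivWithinAt
  · rw [map_sum]
    simp only [evalTensor_tmul, evalSmooth_logDer]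
    simp only [Fin.sum_univ_two, Fin.sum_univ_five, wall, residue, affinePath, Matrix.cons_val,
      Pi.add_apply, Pi.smul_apply, smul_eq_mul]
    set a := (1 - (t : ℝ)) * ξ.1 0 + t * η.1 0 with ha
    set b := (1 - (t : ℝ)) * ξ.1 1 + t * η.1 1 with hb
    have e1 : (1 - (t : ℝ)) * (ξ.1 1 - ξ.1 0) + t * (η.1 1 - η.1 0) = b - a := by
      rw [ha, hb]; ring
    have e2 : (1 - (t : ℝ)) * (1 - ξ.1 0) + t * (1 - η.1 0) = 1 - a := by rw [ha]; ring
    have e3 : (1 - (t : ℝ)) * (1 - ξ.1 1) + t * (1 - η.1 1) = 1 - b := by rw [hb]; ring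
    rw [e1, e2, e3, show (a - b)⁻¹ = -(b - a)⁻¹ by rw [← inv_neg, neg_sub],
      show (a - 1)⁻¹ = -(1 - a)⁻¹ by rw [← inv_neg, neg_sub],
      show (b - 1)⁻¹ = -(1 - b)⁻¹ by rw [← inv_neg, neg_sub]]
    simp only [div_eq_mul_inv, Complex.ofReal_mul, Complex.ofReal_neg, Complex.ofReal_sub]
    module

/-! ## Comparison of an edge with a model path -/

/-- The number `1` as a positive number. -/
def onePos : Set.Ioi (0 : ℝ) := ⟨1, Set.mem_Ioi.2 one_pos⟩

/-- The end values of the affine functions `y`, `1 - y` and `1` on the path from `a` to `1 - b`. -/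
def modelEnds (a b : J) : Fin 3 → Set.Ioi (0 : ℝ) × Set.Ioi (0 : ℝ) :=
  ![(posJ a, oneSubJ b), (oneSubJ a, posJ b), (onePos, onePos)]

theorem integralSeminorm_modelEnds_le {δ a b : J} (ha : (δ : ℝ) ^ 2 ≤ a) (hb : (δ : ℝ) ^ 2 ≤ b)
    (n : Fin 3) :
    integralSeminorm (invAffine (modelEnds a b n).1 (modelEnds a b n).2) ≤
      1 - 4 * Real.log δ := by
  have hδ := J_pos δ
  have hδ1 := δ.2.2
  have hlog := Real.log_nonpos hδ.le (J_le_one δ)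
  have ha1 := a.2.2
  have hb1 := b.2.2
  have hδ2 : (δ : ℝ) ^ 2 ≤ 1 / 4 := by nlinarith
  fin_cases n
  · change integralSeminorm (invAffine (posJ a) (oneSubJ b)) ≤ _
    refine le_trans (b := -(4 * Real.log δ))
      (integralSeminorm_invAffine_le hδ (p := posJ a) (q := oneSubJ b) ha ?_ ?_ ?_ ?_) (by linarith)
    · exact ha1.trans (by norm_num)
    · change _ ≤ 1 - (b : ℝ)
      linarith
    · change 1 - (b : ℝ) ≤ 1
      linarith [b.2.1]
    · refine le_trans ?_ (le_abs_self _)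
      change _ ≤ 1 - (b : ℝ) - a
      linarith
  · change integralSeminorm (invAffine (oneSubJ a) (posJ b)) ≤ _
    refine le_trans (b := -(4 * Real.log δ))
      (integralSeminorm_invAffine_le hδ (p := oneSubJ a) (q := posJ b) ?_ ?_ hb ?_ ?_) (by linarith)
    · change _ ≤ 1 - (a : ℝ)
      linarith
    · change 1 - (a : ℝ) ≤ 1
      linarith [a.2.1]
    · exact hb1.trans (by norm_num)
    · refine le_trans ?_ (neg_le_abs _)
      change _ ≤ -((b : ℝ) - (1 - a))
      linarith
  · change integralSeminorm (invAffine onePos onePos) ≤ _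
    refine (integralSeminorm_invAffine_self onePos).trans ?_
    change (1 : ℝ)⁻¹ ≤ _
    rw [inv_one]
    linarith

theorem modelEnds_le_one (a b : J) (n : Fin 3) :
    ((modelEnds a b n).1 : ℝ) ≤ 1 ∧ ((modelEnds a b n).2 : ℝ) ≤ 1 := by
  have ha := a.2
  have hb := b.2
  match n with
  | 0 => exact ⟨J_le_one a, sub_le_self (1 : ℝ) hb.1.le⟩
  | 1 => exact ⟨sub_le_self (1 : ℝ) ha.1.le, J_le_one b⟩
  | 2 => exact ⟨le_refl (1 : ℝ), le_refl (1 : ℝ)⟩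

theorem one_sub_log_mem_moderate : (fun δ : J => 1 - 4 * Real.log δ) ∈ moderate :=
  moderate.sub_mem (const_mem_moderate 1) (moderate.smul_mem 4 log_mem_moderate)

/-- The parallel transport along an edge on which each of the five affine functions is, up to a
small relative error, proportional to one of the functions of a model path. -/
theorem parallelTransport_edge (A : Fin 4 → Fin 4 → 𝒜) (i j : Fin 5) (a b : J → J)
    (ha : ∀ δ : J, (δ : ℝ) ^ 2 ≤ a δ) (hb : ∀ δ : J, (δ : ℝ) ^ 2 ≤ b δ) (m : Fin 5 → Fin 3)
    (h : ∀ (δ : J) (k : Fin 5),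
      |((wall ⟨vertex δ j, vertex_mem δ j⟩ k : Set.Ioi (0 : ℝ)) : ℝ) *
          (modelEnds (a δ) (b δ) (m k)).1 -
        (wall ⟨vertex δ i, vertex_mem δ i⟩ k) * (modelEnds (a δ) (b δ) (m k)).2| ≤
          2 * δ * (wall ⟨vertex δ i, vertex_mem δ i⟩ k : Set.Ioi (0 : ℝ)) ∧
      |((wall ⟨vertex δ j, vertex_mem δ j⟩ k : Set.Ioi (0 : ℝ)) : ℝ) *
          (modelEnds (a δ) (b δ) (m k)).1 -
        (wall ⟨vertex δ i, vertex_mem δ i⟩ k) * (modelEnds (a δ) (b δ) (m k)).2| ≤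
          2 * δ * (wall ⟨vertex δ j, vertex_mem δ j⟩ k : Set.Ioi (0 : ℝ)))
    (X Y : 𝒜) (hX : X = ∑ k, if m k = 0 then residue A k else 0)
    (hY : Y = ∑ k, if m k = 1 then residue A k else 0) :
    ∃ H ∈ harmlessGroup 𝒜, ∀ δ : J,
      parallelTransport (pentagonConnection A) (edge δ i j) =
        formalExp (Real.log (b δ)) Y * (psi (b δ) Y X : 𝒜⟦X⟧) * evalJ δ H *
          ((psi (a δ) X Y)⁻¹ : (𝒜⟦X⟧)ˣ) * formalExp (-Real.log (a δ)) X := by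
  let f : Fin 3 → Family := fun n δ =>
    logDer (modelEnds (a δ) (b δ) n).1 (modelEnds (a δ) (b δ) n).2
  let u : Fin 5 → Family := fun k δ =>
    logDer (wall ⟨vertex δ i, vertex_mem δ i⟩ k) (wall ⟨vertex δ j, vertex_mem δ j⟩ k)
  let y : Family ⊗[ℂ] 𝒜 := f 0 ⊗ₜ[ℂ] X + f 1 ⊗ₜ[ℂ] Y
  let p : Family ⊗[ℂ] 𝒜 := ∑ k, (u k - f (m k)) ⊗ₜ[ℂ] residue A k
  have hf : ∀ n, f n ∈ boundedFamily integralSeminorm moderate := fun n =>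
    ⟨_, one_sub_log_mem_moderate, fun δ =>
      (integralSeminorm_logDer_le (modelEnds_le_one _ _ n).1 (modelEnds_le_one _ _ n).2).trans
        (integralSeminorm_modelEnds_le (ha δ) (hb δ) n)⟩
  have hy : y ∈ tensorSpan 𝒜 (boundedFamily integralSeminorm moderate) :=
    Submodule.add_mem _ (tmul_mem_tensorSpan (hf 0) X) (tmul_mem_tensorSpan (hf 1) Y)
  have hp : p ∈ tensorSpan 𝒜 (boundedFamily integralSeminorm decaying) := by
    refine Submodule.sum_mem _ fun k _ => tmul_mem_tensorSpan ?_ _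
    -- The resulting bound is `2δ (1 - 4 ln δ)`: the relative error times the `L¹` norm of the
    -- inverse of the model function.
    refine ⟨_, decaying_mul_moderate (decaying.smul_mem 2 id_mem_decaying)
      one_sub_log_mem_moderate, fun δ => ?_⟩
    exact (integralSeminorm_logDer_sub_le (h δ k).1 (h δ k).2).trans
      (mul_le_mul_of_nonneg_left (integralSeminorm_modelEnds_le (ha δ) (hb δ) (m k))
        (mul_nonneg zero_le_two (J_pos δ).le))
  -- The third model function is constant and has zero logarithmic derivative. Its residues are
  -- therefore absent from the model and enter only through the error `p`.
  have hf2 : f 2 = 0 := by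
    funext δ
    refine Subtype.ext (funext fun t => ?_)
    change ((((1 : ℝ) - 1) / _ : ℝ) : ℂ) = 0
    simp
  have hyp : y + p = ∑ k, u k ⊗ₜ[ℂ] residue A k := by
    simp only [y, p, hX, hY, TensorProduct.tmul_sum, ← Finset.sum_add_distrib]
    refine Finset.sum_congr rfl fun k _ => ?_
    have hm : f 0 ⊗ₜ[ℂ] (if m k = 0 then residue A k else 0) +
        f 1 ⊗ₜ[ℂ] (if m k = 1 then residue A k else 0) = f (m k) ⊗ₜ[ℂ] residue A k := by
      generalize m k = n
      fin_cases n
      · simp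
      · simp
      · simp [hf2]
    rw [hm, ← TensorProduct.add_tmul, add_sub_cancel]
  obtain ⟨H, hH, hcmp⟩ := exists_harmless_comparison hy hp fun δ => halfParam (a δ) (b δ)
  refine ⟨H, hH, fun δ => ?_⟩
  have hmy : member δ y = modelForm (a δ) (b δ) X Y := by
    rw [map_add, member_tmul, member_tmul]
    rfl
  have hmp : member δ (y + p) = ∑ k, logDer (wall ⟨vertex δ i, vertex_mem δ i⟩ k)
      (wall ⟨vertex δ j, vertex_mem δ j⟩ k) ⊗ₜ[ℂ] residue A k := by
    rw [hyp, map_sum]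
    exact Finset.sum_congr rfl fun k _ => member_tmul _ _ _
  have key := hcmp δ (parallelTransport (twoPointConnection Y X) (halfPath (b δ)))
    (by rw [hmy]; exact modelForm_transport_right (a δ) (b δ) X Y)
  rw [hmy, evalSeries_halfParam, parallelTransport_halfPath, hmp,
    ← pentagonConnection_alongPath A, ← mul_assoc] at key
  exact key

/-! ### The inequalities for the five edges -/

/-- A pair of bounds on an absolute value, in terms of linear inequalities. -/
theorem abs_le_and_abs_le {w x y : ℝ} (h1 : w ≤ x) (h2 : -w ≤ x) (h3 : w ≤ y) (h4 : -w ≤ y) :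
    |w| ≤ x ∧ |w| ≤ y :=
  ⟨abs_le'.2 ⟨h1, h2⟩, abs_le'.2 ⟨h3, h4⟩⟩

theorem pow_J_bounds (δ : J) (n : ℕ) :
    0 < (δ : ℝ) ^ n ∧ (δ : ℝ) ^ (n + 1) ≤ (δ : ℝ) ^ n * (1 / 4) := by
  have h := pow_pos (J_pos δ) n
  exact ⟨h, by rw [pow_succ]; exact mul_le_mul_of_nonneg_left δ.2.2 h.le⟩

theorem sq_le_J (δ : J) : (δ : ℝ) ^ 2 ≤ δ := by
  nlinarith [J_pos δ, J_le_one δ]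

end

end KZPentagon

theorem mainTheorem4 {𝒜 : Type*} [Ring 𝒜] [Algebra ℂ 𝒜] (A : Fin 4 → Fin 4 → 𝒜)
    (hA : InfinitesimalBraid A) :
    ∃ H : Fin 5 → ((J → ℂ) ⊗[ℂ] 𝒜)⟦X⟧,
      (∀ i, H i ∈ harmlessGroup 𝒜) ∧
      ∀ δ : J,
        parallelTransport (pentagonConnection A) (edge δ 0 1) =
          formalExp (Real.log δ) (A 1 2) *
          (psi δ (A 1 2) (A 0 1) : 𝒜⟦X⟧) *
          evalJ δ (H 0) *
          ((psi δ (A 0 1) (A 1 2))⁻¹ : (𝒜⟦X⟧)ˣ) *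
          formalExp (-Real.log δ) (A 0 1) ∧
        parallelTransport (pentagonConnection A) (edge δ 1 2) =
          formalExp (Real.log δ) (A 1 3 + A 2 3) *
          (psi δ (A 1 3 + A 2 3) (A 0 1 + A 0 2) : 𝒜⟦X⟧) *
          evalJ δ (H 1) *
          ((psi δ (A 0 1 + A 0 2) (A 1 3 + A 2 3))⁻¹ : (𝒜⟦X⟧)ˣ) *
          formalExp (-Real.log δ) (A 0 1 + A 0 2) ∧
        parallelTransport (pentagonConnection A) (edge δ 2 3) =
          formalExp (Real.log δ) (A 2 3) *
          (psi δ (A 2 3) (A 1 2) : 𝒜⟦X⟧) *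
          evalJ δ (H 2) *
          ((psi δ (A 1 2) (A 2 3))⁻¹ : (𝒜⟦X⟧)ˣ) *
          formalExp (-Real.log δ) (A 1 2) ∧
        parallelTransport (pentagonConnection A) (edge δ 0 4) =
          formalExp (Real.log ((δ : ℝ) ^ 2)) (A 2 3) *
          (psi (sqJ δ) (A 2 3) (A 0 2 + A 1 2) : 𝒜⟦X⟧) *
          evalJ δ (H 3) *
          ((psi δ (A 0 2 + A 1 2) (A 2 3))⁻¹ : (𝒜⟦X⟧)ˣ) *
          formalExp (-Real.log δ) (A 0 2 + A 1 2) ∧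
        parallelTransport (pentagonConnection A) (edge δ 4 3) =
          formalExp (Real.log δ) (A 1 2 + A 1 3) *
          (psi δ (A 1 2 + A 1 3) (A 0 1) : 𝒜⟦X⟧) *
          evalJ δ (H 4) *
          ((psi (sqJ δ) (A 0 1) (A 1 2 + A 1 3))⁻¹ : (𝒜⟦X⟧)ˣ) *
          formalExp (-Real.log ((δ : ℝ) ^ 2)) (A 0 1) := by
  -- Once each power of `δ` is known to be at most a quarter of the preceding one, the Wronskian
  -- bounds become linear in the powers, taken as independent unknowns.
  have hδ : ∀ δ : J, (0 < (δ : ℝ) ^ 1 ∧ (δ : ℝ) ^ 2 ≤ (δ : ℝ) ^ 1 * (1 / 4)) ∧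
      (0 < (δ : ℝ) ^ 2 ∧ (δ : ℝ) ^ 3 ≤ (δ : ℝ) ^ 2 * (1 / 4)) ∧
      (0 < (δ : ℝ) ^ 3 ∧ (δ : ℝ) ^ 4 ≤ (δ : ℝ) ^ 3 * (1 / 4)) ∧
      0 < (δ : ℝ) ^ 4 ∧ (δ : ℝ) ^ 5 ≤ (δ : ℝ) ^ 4 * (1 / 4) := fun δ =>
    ⟨pow_J_bounds δ 1, pow_J_bounds δ 2, pow_J_bounds δ 3, pow_J_bounds δ 4⟩
  -- The vectors list the models of the five affine functions: `0` for `y`, `1` for `1 - y`, `2` for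
  -- a constant. Here `x₂ = δ y` and `x₃ - x₂ = δ (1 - y)` exactly, and the only error comes from `1
  -- - x₂`.
  obtain ⟨H01, h01, e01⟩ := parallelTransport_edge A 0 1 id id (fun δ => sq_le_J δ)
    (fun δ => sq_le_J δ) ![0, 2, 1, 2, 2] (fun δ k => by
      obtain ⟨⟨p1, q1⟩, ⟨p2, q2⟩, ⟨p3, q3⟩, p4, q4⟩ := hδ δ
      fin_cases k <;>
        simp only [wall, vertex, modelEnds, posJ, oneSubJ, onePos, id, Fin.isValue,
          Fin.zero_eta, Fin.mk_one, Fin.reduceFinMk, Matrix.cons_val, Matrix.cons_val_zero,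
          Matrix.cons_val_one] <;>
        apply abs_le_and_abs_le <;> linarith)
    (A 0 1) (A 1 2) (by simp [Fin.sum_univ_five, residue]) (by simp [Fin.sum_univ_five, residue])
  -- The points 2 and 3 stay at the constant distance `δ²` and move together, so the residues at `0`
  -- and at `1` add up.
  obtain ⟨H12, h12, e12⟩ := parallelTransport_edge A 1 2 id id (fun δ => sq_le_J δ)
    (fun δ => sq_le_J δ) ![0, 0, 2, 1, 1] (fun δ k => by
      obtain ⟨⟨p1, q1⟩, ⟨p2, q2⟩, ⟨p3, q3⟩, p4, q4⟩ := hδ δ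
      fin_cases k <;>
        simp only [wall, vertex, modelEnds, posJ, oneSubJ, onePos, id, Fin.isValue,
          Fin.zero_eta, Fin.mk_one, Fin.reduceFinMk, Matrix.cons_val, Matrix.cons_val_zero,
          Matrix.cons_val_one] <;>
        apply abs_le_and_abs_le <;> linarith)
    (A 0 1 + A 0 2) (A 1 3 + A 2 3) (by simp [Fin.sum_univ_five, residue]) (by simp [Fin.sum_univ_five, residue])
  obtain ⟨H23, h23, e23⟩ := parallelTransport_edge A 2 3 id id (fun δ => sq_le_J δ)
    (fun δ => sq_le_J δ) ![2, 2, 0, 2, 1] (fun δ k => by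
      obtain ⟨⟨p1, q1⟩, ⟨p2, q2⟩, ⟨p3, q3⟩, p4, q4⟩ := hδ δ
      fin_cases k <;>
        simp only [wall, vertex, modelEnds, posJ, oneSubJ, onePos, id, Fin.isValue,
          Fin.zero_eta, Fin.mk_one, Fin.reduceFinMk, Matrix.cons_val, Matrix.cons_val_zero,
          Matrix.cons_val_one] <;>
        apply abs_le_and_abs_le <;> linarith)
    (A 1 2) (A 2 3) (by simp [Fin.sum_univ_five, residue]) (by simp [Fin.sum_univ_five, residue])
  -- Here `y = x₃` runs from `δ` to `1 - δ²` with `x₂ = δ²` fixed; the errors come from `x₃ - x₂`,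
  -- compared with `y`.
  obtain ⟨H04, h04, e04⟩ := parallelTransport_edge A 0 4 id sqJ (fun δ => sq_le_J δ)
    (fun δ => le_rfl) ![2, 0, 0, 2, 1] (fun δ k => by
      obtain ⟨⟨p1, q1⟩, ⟨p2, q2⟩, ⟨p3, q3⟩, p4, q4⟩ := hδ δ
      fin_cases k <;>
        simp only [wall, vertex, modelEnds, posJ, oneSubJ, onePos, sqJ, id, Fin.isValue,
          Fin.zero_eta, Fin.mk_one, Fin.reduceFinMk, Matrix.cons_val, Matrix.cons_val_zero,
          Matrix.cons_val_one] <;>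
        apply abs_le_and_abs_le <;> linarith)
    (A 0 2 + A 1 2) (A 2 3) (by simp [Fin.sum_univ_five, residue]) (by simp [Fin.sum_univ_five, residue])
  -- Here `y = x₂` runs from `δ²` to `1 - δ` with `x₃ = 1 - δ²` fixed; the errors come from `x₃ -
  -- x₂`, compared with `1 - y`.
  obtain ⟨H43, h43, e43⟩ := parallelTransport_edge A 4 3 sqJ id (fun δ => le_rfl)
    (fun δ => sq_le_J δ) ![0, 2, 1, 1, 2] (fun δ k => by
      obtain ⟨⟨p1, q1⟩, ⟨p2, q2⟩, ⟨p3, q3⟩, p4, q4⟩ := hδ δ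
      fin_cases k <;>
        simp only [wall, vertex, modelEnds, posJ, oneSubJ, onePos, sqJ, id, Fin.isValue,
          Fin.zero_eta, Fin.mk_one, Fin.reduceFinMk, Matrix.cons_val, Matrix.cons_val_zero,
          Matrix.cons_val_one] <;>
        apply abs_le_and_abs_le <;> linarith)
    (A 0 1) (A 1 2 + A 1 3) (by simp [Fin.sum_univ_five, residue]) (by simp [Fin.sum_univ_five, residue])
  refine ⟨![H01, H12, H23, H04, H43], fun i => ?_,
    fun δ => ⟨e01 δ, e12 δ, e23 δ, e04 δ, e43 δ⟩⟩
  fin_cases i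
  exacts [h01, h12, h23, h04, h43]
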